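/- **Theorem (framed Khovanov homology of the torus links $T(2,n)$).** *Conventions.* Let $D$ be an unoriented link diagram with a fixed linear order on its crossings. A Kauffman state $s$ puts a marker $A$ or $B$ on every crossing; the $A$-smoothing of a crossing joins the two regions swept by the upper strand when it is turned counterclockwise, and the $B$-smoothing joins the other two. Let $D_s$ be the resulting set of circles. An enhanced state $S$ is a state $s$ together with a sign $\varepsilon(c)\in\{+,-\}$ for every circle $c\in D_s$. Put $\sigma(s)=|s^{-1}(A)|-|s^{-1}(B)|$ and $\tau(S)=|\varepsilon^{-1}(+)|-|\varepsilon^{-1}(-)|$. Let $C_{a,b}(D)$ be the free abelian group on the enhanced states with $a=\sigma(s)$ and $b=\sigma(s)+2\tau(S)$, and define $$\partial_{a,b}\colon C_{a,b}(D)\to C_{a-2,b}(D),\qquad \partial_{a,b}(S)=\sum_{S'}(-1)^{t(S,S')}(S,S')\,S'.$$ Here $(S,S')=1$ if there is a crossing $v$ with marker $A$ in $S$ and $B$ in $S'$, all other markers agree, $\tau(S')=\tau(S)+1$, and all circles not passing through $v$ have the same sign in $S$ and $S'$; otherwise $(S,S')=0$. The number $t(S,S')$ counts the crossings after $v$ that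 have marker $B$ in $S$. The framed (Viro convention) Khovanov homology of $D$ is $H_{a,b}(D)=\ker\partial_{a,b}/\operatorname{im}\partial_{a+2,b}$. *Statement.* Let $n\ge 1$ be an integer and let $T(2,n)$ be given by its standard diagram, the closure of the two-strand braid $\sigma_1^n$ with $n$ positive crossings, ordered along the braid (for $n=1$ this is the unknot with one positive kink). Then, for all integers $a,b$, $$H_{a,b}(T(2,n))\cong\begin{cases} \mathbb Z & \text{if } (a,b)=(n,n),\\ \mathbb Z & \text{if } n\ge 2 \text{ and } (a,b)=(-n,-3n),\\ \mathbb Z & \text{if } (a,b)=(n-2s,\,n-4s+4) \text{ for some even } s \text{ with } 0\le s\le n,\\ \mathbb Z & \text{if } (a,b)=(n-2s,\,n-4s) \text{ for some odd } s \text{ with } 3\le s\le n,\\ \mathbb Z_2 & \text{if } (a,b)=(n-2s,\,n-4s+4) \text{ for some odd } s \text{ with } 3\le s\le n,\\ 0 & \text{otherwise.} \end{cases}$$ -/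

import Mathlib

/-- The two markers that a Kauffman state can put on a crossing. -/
inductive Marker where
  | A
  | B
  deriving DecidableEq

instance : Fintype Marker where
  elems := {Marker.A, Marker.B}
  complete := by rintro (_ | _) <;> simp

/-- The two signs that an enhanced Kauffman state can put on a circle. -/
inductive CircleSign where
  | plus
  | minus
  deriving DecidableEq

instance : Fintype CircleSign where
  elems := {CircleSign.plus, CircleSign.minus}
  complete := by rintro (_ | _) <;> simp

/-- An unoriented planar diagram (PD) code with set of crossings `X` and set of edges `E`.
At a crossing `v`, the four edges `label v 0`, `label v 1`, `label v 2`, `label v 3` are listed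
counterclockwise, and `label v 0`, `label v 2` are the two ends of the lower strand (so
`label v 1`, `label v 3` are the two ends of the upper strand).
Every edge has two ends at crossings, or none: in the latter case it is a
component of the diagram without crossings. -/
structure PDCode (X E : Type) where
  label : X → Fin 4 → E
  two_ends : ∀ e : E, Nat.card {p : X × Fin 4 // label p.1 p.2 = e} = 0 ∨
    Nat.card {p : X × Fin 4 // label p.1 p.2 = e} = 2

namespace PDCode

variable {X E : Type}

/-- `D.Arc s e f`: smoothing the crossings of `D` by the state `s` produces an arc
joining an end of the edge `e` to an end of the edge `f`. The `A`-smoothing joins the two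
regions swept by the upper strand when it is turned counterclockwise, so its arcs are `0 - 1`
and `2 - 3`; the arcs of the `B`-smoothing are `0 - 3` and `1 - 2`. -/
def Arc (D : PDCode X E) (s : X → Marker) (e f : E) : Prop :=
  ∃ v : X,
    (s v = Marker.A ∧ ((e = D.label v 0 ∧ f = D.label v 1) ∨
      (e = D.label v 2 ∧ f = D.label v 3))) ∨
    (s v = Marker.B ∧ ((e = D.label v 0 ∧ f = D.label v 3) ∨
      (e = D.label v 1 ∧ f = D.label v 2)))

/-- The set `D_s` of circles of the smoothed diagram: the classes of edges joined by arcs. -/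
def Circle (D : PDCode X E) (s : X → Marker) : Type :=
  Quotient (Relation.EqvGen.setoid (D.Arc s))

/-- The circle of `D_s` that contains the edge `e`. -/
def circleOf (D : PDCode X E) (s : X → Marker) (e : E) : D.Circle s :=
  Quotient.mk (Relation.EqvGen.setoid (D.Arc s)) e

/-- Enhanced Kauffman states: a state `s` and a sign for every circle of `D_s`. -/
def EnhancedState (D : PDCode X E) : Type :=
  Σ s : X → Marker, (D.Circle s → CircleSign)

instance [Finite E] (D : PDCode X E) (s : X → Marker) : Finite (D.Circle s) :=
  inferInstanceAs (Finite (Quotient (Relation.EqvGen.setoid (D.Arc s))))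

instance [Finite X] [Finite E] (D : PDCode X E) : Finite D.EnhancedState :=
  inferInstanceAs (Finite (Σ s : X → Marker, (D.Circle s → CircleSign)))

/-- The number of `A`-markers minus the number of `B`-markers. -/
noncomputable def sigma {D : PDCode X E} (S : D.EnhancedState) : ℤ :=
  (Nat.card {v : X // S.1 v = Marker.A} : ℤ) - (Nat.card {v : X // S.1 v = Marker.B} : ℤ)

/-- The number of positive circles minus the number of negative circles. -/
noncomputable def tau {D : PDCode X E} (S : D.EnhancedState) : ℤ :=
  (Nat.card {c : D.Circle S.1 // S.2 c = CircleSign.plus} : ℤ) -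
    (Nat.card {c : D.Circle S.1 // S.2 c = CircleSign.minus} : ℤ)

/-- The set `𝒮_{a,b}` of enhanced states of bidegree `(a, b)`. -/
def BidegreeState (D : PDCode X E) (a b : ℤ) : Type :=
  {S : D.EnhancedState // a = sigma S ∧ b = sigma S + 2 * tau S}

instance [Finite X] [Finite E] (D : PDCode X E) (a b : ℤ) : Finite (D.BidegreeState a b) :=
  inferInstanceAs (Finite {S : D.EnhancedState // a = sigma S ∧ b = sigma S + 2 * tau S})

noncomputable instance [Finite X] [Finite E] (D : PDCode X E) (a b : ℤ) :
    Fintype (D.BidegreeState a b) :=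
  Fintype.ofFinite _

/-- The chain group `C_{a,b}`, free abelian on the enhanced states of bidegree `(a, b)`. -/
abbrev Chain (D : PDCode X E) (a b : ℤ) : Type :=
  D.BidegreeState a b →₀ ℤ

/-- `S` and `S'` are incident, and `v` is the crossing where they differ: the marker of `v`
changes from `A` to `B`, all other markers agree, `τ` grows by one, and the circles of `D_s` that
do not pass through `v` keep their signs. -/
def IncidentAt (D : PDCode X E) (v : X) (S S' : D.EnhancedState) : Prop :=
  S.1 v = Marker.A ∧ S'.1 v = Marker.B ∧ (∀ w : X, w ≠ v → S'.1 w = S.1 w) ∧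
    tau S' = tau S + 1 ∧
    ∀ e : E, (∀ i : Fin 4, D.circleOf S.1 (D.label v i) ≠ D.circleOf S.1 e) →
      S'.2 (D.circleOf S'.1 e) = S.2 (D.circleOf S.1 e)

open Classical in
/-- The coefficient `(-1)^{t(S,S')} (S,S')` of the differential. Two enhanced states are incident
at no more than one crossing `v`, so the sum has at most one nonzero term; the exponent counts
the crossings after `v` that carry a `B`-marker. -/
noncomputable def coefficient [Fintype X] [LinearOrder X] (D : PDCode X E)
    (S S' : D.EnhancedState) : ℤ :=
  ∑ v : X, if D.IncidentAt v S S' then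
    (-1) ^ Nat.card {w : X // v < w ∧ S.1 w = Marker.B} else 0

/-- The component `C_{a,b} → C_{a',b}` of the differential. It vanishes unless `a' = a - 2`, since
`σ` drops by two between incident states; `∂_{a,b}` is the component with `a' = a - 2`. -/
noncomputable def differential [Fintype X] [LinearOrder X] [Finite E] (D : PDCode X E)
    (a a' b : ℤ) : D.Chain a b →ₗ[ℤ] D.Chain a' b :=
  Finsupp.linearCombination ℤ fun S : D.BidegreeState a b =>
    ∑ S' : D.BidegreeState a' b, D.coefficient S.1 S'.1 • Finsupp.single S' (1 : ℤ)

/-- The framed Khovanov homology `H_{a,b}(D) = ker ∂_{a,b} / im ∂_{a+2,b}`. -/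
abbrev KhovanovHomology [Fintype X] [LinearOrder X] [Finite E] (D : PDCode X E) (a b : ℤ) : Type :=
  LinearMap.ker (D.differential a (a - 2) b) ⧸
    (LinearMap.range (D.differential (a + 2) a b)).submoduleOf
      (LinearMap.ker (D.differential a (a - 2) b))

end PDCode

/-- The edges at the crossing `i` of the closure of the two-strand braid `σ₁ⁿ`. Crossings are
numbered cyclically from bottom to top; `(i, false)` and `(i, true)` are the left and right edges
that enter the crossing `i` from below, and those that leave it upwards enter the next
crossing. The upper strand runs from bottom left to top right, so the crossing is positive when
both strands are directed upwards. -/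
def torusLabel (n : ℕ) (i : Fin n) : Fin 4 → Fin n × Bool :=
  ![(i, true), (finRotate n i, true), (finRotate n i, false), (i, false)]

theorem torusLabel_two_ends (n : ℕ) (e : Fin n × Bool) :
    Nat.card {p : Fin n × Fin 4 // torusLabel n p.1 p.2 = e} = 2 := by
  obtain ⟨j, c⟩ := e
  have key : ∀ k l : Fin 4, k ≠ l →
      (∀ p : Fin n × Fin 4, torusLabel n p.1 p.2 = (j, c) ↔
        p = (j, k) ∨ p = ((finRotate n).symm j, l)) →
      Nat.card {p : Fin n × Fin 4 // torusLabel n p.1 p.2 = (j, c)} = 2 := by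
    intro k l hkl h
    have hs : {p : Fin n × Fin 4 | torusLabel n p.1 p.2 = (j, c)} =
        {(j, k), ((finRotate n).symm j, l)} := by
      ext p
      simpa using h p
    have h2 := Set.ncard_pair (a := (j, k)) (b := ((finRotate n).symm j, l))
      (fun hp => hkl (congrArg Prod.snd hp))
    rw [← hs] at h2
    exact h2
  cases c
  · refine key 3 2 (by decide) ?_
    rintro ⟨i, m⟩
    unfold torusLabel
    generalize finRotate n = r
    fin_cases m <;> simp [Equiv.eq_symm_apply]
  · refine key 0 1 (by decide) ?_
    rintro ⟨i, m⟩
    unfold torusLabel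
    generalize finRotate n = r
    fin_cases m <;> simp [Equiv.eq_symm_apply]

/-- The standard diagram of the torus link `T(2, n)`: the closure of the two-strand braid `σ₁ⁿ`,
with `n` positive crossings, ordered along the braid. -/
def torusLinkDiagram (n : ℕ) : PDCode (Fin n) (Fin n × Bool) where
  label := torusLabel n
  two_ends := fun e => Or.inr (torusLabel_two_ends n e)

/-! Let 𝒜 = ℤ[X]/(X²), with `minus` as 1 and `plus` as X. Merging two circles is then the
multiplication of 𝒜, and splitting a circle is the comultiplication 1 ↦ 1⊗X + X⊗1, X ↦ X⊗X. If the
last crossing of the closure of σ₁ⁿ⁺¹ is smoothed by A, the closure of σ₁ⁿ remains; if it is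
smoothed by B, a circle with n kinks remains. Hence the complex of T(2,n+1) is the mapping cone of a
chain map `closeUp n` from the complex of T(2,n) to that of a row of n kinks. The types `TorusWord`,
`ArcWord` and all matrices follow this recursion; matrices act on row vectors of coefficients.

Kinks are removed as in the first Reidemeister move: the comultiplication is injective with cokernel
𝒜, so a row of m kinks retracts onto one copy of 𝒜 in its all-B state (`arcAug`,
`exists_arcDiff_eq`). In the cokernel t⊗X = -Xt⊗1. Therefore X on the first circle of the row
becomes X, but X on the last circle becomes (-1)^m X (`arcAug_baseX_plus`, `arcAug_lastX_plus`).
After a B-smoothed last crossing, `closeUp` is a splitting, and it becomes X ± X on 𝒜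
(`arcAug_closeUp`). By induction T(2,n) reduces to 𝒜⊗𝒜 → 𝒜 → 𝒜 → 𝒜 → ⋯, with n copies of 𝒜 after
𝒜⊗𝒜; the maps are multiplication, then 0, 2X, 0, 2X, and so on. The retraction `torusAug` is a chain
map onto this complex with acyclic kernel (`torusAug_torusDiff`, `exists_torusAug_eq`,
`exists_torusDiff_eq`).

Its homology is immediate. The kernel of multiplication is spanned by 1⊗X - X⊗1 and X⊗X, and
multiplication is onto. Each 2X leaves a ℤ spanned by X in its source, and ℤ₂ (from X) and ℤ (from
1) in its target. If n is even, the last copy of 𝒜 is not the source of a map, so its 1 survives as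
well.

It remains to match words with enhanced states of the planar diagram. An edge entering crossing j
lies on the circle that starts at the last B-crossing cyclically before j (`cyclicMark`). This makes
`toState` a bijection that respects the gradings and the signed incidence numbers
(`coefficient_toState`). `nonempty_homology_equiv` then carries the computation over. -/

namespace TorusModel

open Matrix CircleSign

/-! ### Words for enhanced states, and the matrices of the complexes -/

/-- Resolutions of a row of `m` kinks: the sign of the circle that starts the row and, for every
kink, nothing (`A`-smoothing) or the sign of the circle that starts there (`B`-smoothing). -/
def ArcWord : ℕ → Type
  | 0 => CircleSign
  | m + 1 => ArcWord m × Option CircleSign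

/-- Enhanced states of the closed two-strand braid with `n` crossings: either the last crossing has
marker `A`, or it starts a row of `n - 1` kinks. -/
def TorusWord : ℕ → Type
  | 0 => CircleSign × CircleSign
  | n + 1 => TorusWord n ⊕ ArcWord n

instance ArcWord.instFintype : ∀ m, Fintype (ArcWord m)
  | 0 => inferInstanceAs (Fintype CircleSign)
  | m + 1 =>
    have := ArcWord.instFintype m
    inferInstanceAs (Fintype (ArcWord m × Option CircleSign))

instance ArcWord.instDecidableEq : ∀ m, DecidableEq (ArcWord m)
  | 0 => inferInstanceAs (DecidableEq CircleSign)
  | m + 1 =>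
    have := ArcWord.instDecidableEq m
    inferInstanceAs (DecidableEq (ArcWord m × Option CircleSign))

instance TorusWord.instFintype : ∀ n, Fintype (TorusWord n)
  | 0 => inferInstanceAs (Fintype (CircleSign × CircleSign))
  | n + 1 =>
    have := TorusWord.instFintype n
    inferInstanceAs (Fintype (TorusWord n ⊕ ArcWord n))

theorem sum_circleSign (f : CircleSign → ℤ) : ∑ ε, f ε = f plus + f minus := by
  have : (Finset.univ : Finset CircleSign) = {plus, minus} := by ext x; cases x <;> simp
  rw [this, Finset.sum_pair (by decide)]

theorem sum_arcWord_succ {m : ℕ} (f : ArcWord (m + 1) → ℤ) :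
    ∑ t, f t = ∑ t, f (t, none) + (∑ t, f (t, some plus) + ∑ t, f (t, some minus)) := by
  refine (Fintype.sum_prod_type fun p : ArcWord m × Option CircleSign => f p).trans ?_
  simp only [Fintype.sum_option, sum_circleSign, Finset.sum_add_distrib]

theorem sum_torusWord_succ {n : ℕ} (f : TorusWord (n + 1) → ℤ) :
    ∑ c, f c = ∑ c, f (Sum.inl c) + ∑ t, f (Sum.inr t) :=
  Fintype.sum_sum_type fun p : TorusWord n ⊕ ArcWord n => f p

/-- Multiplication by `X` on a circle: it turns the sign `minus` into `plus`. -/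
def signX : Matrix CircleSign CircleSign ℤ
  | minus, plus => 1
  | _, _ => 0

/-- Multiplication by `X` on the last circle of a row. -/
def lastX : ∀ m, Matrix (ArcWord m) (ArcWord m) ℤ
  | 0 => signX
  | m + 1 => fun p p' => match p, p' with
    | (t, none), (t', none) => lastX m t t'
    | (t, some minus), (t', some plus) => if t = t' then 1 else 0
    | _, _ => 0

/-- Multiplication by `X` on the first circle of a row. -/
def baseX : ∀ m, Matrix (ArcWord m) (ArcWord m) ℤ
  | 0 => signX
  | m + 1 => fun p p' => if p.2 = p'.2 then baseX m p.1 p'.1 else 0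

/-- The differential of a row of kinks. -/
def arcDiff : ∀ m, Matrix (ArcWord m) (ArcWord m) ℤ
  | 0 => 0
  | m + 1 => fun p p' => match p, p' with
    | (t, none), (t', none) => arcDiff m t t'
    -- The last kink splits the last circle of `t` by t ↦ t⊗X + Xt⊗1, the second factor being the
    -- new circle.
    | (t, none), (t', some plus) => if t = t' then 1 else 0
    | (t, none), (t', some minus) => lastX m t t'
    | (_, some _), (_, none) => 0
    -- The last kink is a B-marker after all the other kinks, hence one sign.
    | (t, some ε), (t', some ε') => if ε = ε' then -arcDiff m t t' else 0

/-- The retraction of the complex of a row of kinks onto the complex of one circle. -/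
def arcAug : ∀ m, Matrix (ArcWord m) CircleSign ℤ
  | 0 => (1 : Matrix CircleSign CircleSign ℤ)
  | m + 1 => fun p ε => match p, ε with
    | (_, none), _ => 0
    | (t, some minus), ε => arcAug m t ε
    -- In the cokernel of the splitting t⊗X = -Xt⊗1, with X on the last circle of `t`; that X
    -- becomes (-1)^m X under the retraction.
    | (t, some plus), plus => (-1) ^ (m + 1) * arcAug m t minus
    | (_, some plus), minus => 0

/-- The change of the marker of an additional last crossing from `A` to `B`. -/
def closeUp : ∀ n, Matrix (TorusWord n) (ArcWord n) ℤ
  | 0 => fun p ε => match p, ε with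
    | (plus, minus), plus => 1
    | (minus, plus), plus => 1
    | (minus, minus), minus => 1
    | _, _ => 0
  | n + 1 => fun p p' => match p, p' with
    | Sum.inl c, (t', none) => closeUp n c t'
    -- The additional crossing splits the base circle of `t`: the part below it becomes the circle
    -- that starts at place `n`, the part above it is the new base circle.
    | Sum.inr t, (t', some plus) => if t = t' then 1 else 0
    | Sum.inr t, (t', some minus) => baseX n t t'
    | _, _ => 0

/-- The differential of the closed two-strand braid. -/
def torusDiff : ∀ n, Matrix (TorusWord n) (TorusWord n) ℤ
  | 0 => 0
  | n + 1 => fun p p' => match p, p' with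
    | Sum.inl c, Sum.inl c' => torusDiff n c c'
    | Sum.inl c, Sum.inr t' => closeUp n c t'
    -- The last crossing has marker B and comes after all others.
    | Sum.inr t, Sum.inr t' => -arcDiff n t t'
    | Sum.inr _, Sum.inl _ => 0

/-- Generators of the reduced complex: those of two circles in degree `0`, and `(k, ε)` for one
circle in degree `k + 1`. -/
abbrev Reduced : Type := (CircleSign × CircleSign) ⊕ (ℕ × CircleSign)

/-- The retraction of the complex of the closed braid onto the reduced complex. -/
def torusAug : ∀ n, Matrix (TorusWord n) Reduced ℤ
  | 0 => fun p i => match i with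
    | Sum.inl q => (1 : Matrix (CircleSign × CircleSign) (CircleSign × CircleSign) ℤ) p q
    | Sum.inr _ => 0
  | n + 1 => fun p i => match p, i with
    | Sum.inl c, i => torusAug n c i
    | Sum.inr _, Sum.inl _ => 0
    | Sum.inr t, Sum.inr (k, ε) => if k = n then arcAug n t ε else 0

/-- The differential of the reduced complex. -/
def reducedDiff (n : ℕ) (x : Reduced → ℤ) : Reduced → ℤ
  | Sum.inl _ => 0
  | Sum.inr (0, plus) => if 0 < n then x (Sum.inl (plus, minus)) + x (Sum.inl (minus, plus)) else 0
  | Sum.inr (0, minus) => if 0 < n then x (Sum.inl (minus, minus)) else 0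
  -- The map is (1 + (-1)^(k+1)) X: twice X for odd `k`, zero for even `k`. The bound ends the
  -- complex after `n` copies of 𝒜.
  | Sum.inr (k + 1, plus) => if k + 1 < n ∧ Odd k then 2 * x (Sum.inr (k, minus)) else 0
  | Sum.inr (_ + 1, minus) => 0

/-! ### The matrices in components -/

section Components

variable {m n : ℕ}

theorem vecMul_signX_plus (z : CircleSign → ℤ) : (z ᵥ* signX) plus = z minus := by
  simp [vecMul, dotProduct, sum_circleSign, signX]

theorem vecMul_signX_minus (z : CircleSign → ℤ) : (z ᵥ* signX) minus = 0 := by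
  simp [vecMul, dotProduct, signX]

theorem lastX_none (z : ArcWord (m + 1) → ℤ) (t : ArcWord m) :
    (z ᵥ* lastX (m + 1)) (t, none) = ((fun t => z (t, none)) ᵥ* lastX m) t := by
  simp [vecMul, dotProduct, sum_arcWord_succ, lastX]

theorem lastX_plus (z : ArcWord (m + 1) → ℤ) (t : ArcWord m) :
    (z ᵥ* lastX (m + 1)) (t, some plus) = z (t, some minus) := by
  simp [vecMul, dotProduct, sum_arcWord_succ, lastX]

theorem lastX_minus (z : ArcWord (m + 1) → ℤ) (t : ArcWord m) :
    (z ᵥ* lastX (m + 1)) (t, some minus) = 0 := by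
  simp [vecMul, dotProduct, sum_arcWord_succ, lastX]

theorem baseX_apply (z : ArcWord (m + 1) → ℤ) (t : ArcWord m) (l : Option CircleSign) :
    (z ᵥ* baseX (m + 1)) (t, l) = ((fun t => z (t, l)) ᵥ* baseX m) t := by
  rcases l with _ | _ | _ <;> simp [vecMul, dotProduct, sum_arcWord_succ, baseX]

theorem arcDiff_none (z : ArcWord (m + 1) → ℤ) (t : ArcWord m) :
    (z ᵥ* arcDiff (m + 1)) (t, none) = ((fun t => z (t, none)) ᵥ* arcDiff m) t := by
  simp [vecMul, dotProduct, sum_arcWord_succ, arcDiff]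

theorem arcDiff_plus (z : ArcWord (m + 1) → ℤ) (t : ArcWord m) :
    (z ᵥ* arcDiff (m + 1)) (t, some plus) =
      z (t, none) - ((fun t => z (t, some plus)) ᵥ* arcDiff m) t := by
  simp [vecMul, dotProduct, sum_arcWord_succ, arcDiff, sub_eq_add_neg]

theorem arcDiff_minus (z : ArcWord (m + 1) → ℤ) (t : ArcWord m) :
    (z ᵥ* arcDiff (m + 1)) (t, some minus) =
      ((fun t => z (t, none)) ᵥ* lastX m) t - ((fun t => z (t, some minus)) ᵥ* arcDiff m) t := by
  simp [vecMul, dotProduct, sum_arcWord_succ, arcDiff, sub_eq_add_neg]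

theorem arcAug_plus (z : ArcWord (m + 1) → ℤ) :
    (z ᵥ* arcAug (m + 1)) plus = ((fun t => z (t, some minus)) ᵥ* arcAug m) plus +
      (-1) ^ (m + 1) * ((fun t => z (t, some plus)) ᵥ* arcAug m) minus := by
  simp [vecMul, dotProduct, sum_arcWord_succ, arcAug, Finset.mul_sum, mul_left_comm, add_comm]

theorem arcAug_minus (z : ArcWord (m + 1) → ℤ) :
    (z ᵥ* arcAug (m + 1)) minus = ((fun t => z (t, some minus)) ᵥ* arcAug m) minus := by
  simp [vecMul, dotProduct, sum_arcWord_succ, arcAug]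

theorem arcAug_zero (z : ArcWord 0 → ℤ) (ε : CircleSign) : (z ᵥ* arcAug 0) ε = z ε := by
  exact congrFun (vecMul_one (z : CircleSign → ℤ)) ε

theorem closeUp_none (z : TorusWord (n + 1) → ℤ) (t : ArcWord n) :
    (z ᵥ* closeUp (n + 1)) (t, none) = ((fun c => z (Sum.inl c)) ᵥ* closeUp n) t := by
  simp [vecMul, dotProduct, sum_torusWord_succ, closeUp]

theorem closeUp_plus (z : TorusWord (n + 1) → ℤ) (t : ArcWord n) :
    (z ᵥ* closeUp (n + 1)) (t, some plus) = z (Sum.inr t) := by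
  simp [vecMul, dotProduct, sum_torusWord_succ, closeUp]

theorem closeUp_minus (z : TorusWord (n + 1) → ℤ) (t : ArcWord n) :
    (z ᵥ* closeUp (n + 1)) (t, some minus) = ((fun t => z (Sum.inr t)) ᵥ* baseX n) t := by
  simp [vecMul, dotProduct, sum_torusWord_succ, closeUp]

theorem torusDiff_inl (z : TorusWord (n + 1) → ℤ) (c : TorusWord n) :
    (z ᵥ* torusDiff (n + 1)) (Sum.inl c) = ((fun c => z (Sum.inl c)) ᵥ* torusDiff n) c := by
  simp [vecMul, dotProduct, sum_torusWord_succ, torusDiff]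

theorem torusDiff_inr (z : TorusWord (n + 1) → ℤ) (t : ArcWord n) :
    (z ᵥ* torusDiff (n + 1)) (Sum.inr t) =
      ((fun c => z (Sum.inl c)) ᵥ* closeUp n) t - ((fun t => z (Sum.inr t)) ᵥ* arcDiff n) t := by
  simp [vecMul, dotProduct, sum_torusWord_succ, torusDiff, sub_eq_add_neg]

theorem torusAug_of_le : ∀ {n : ℕ} (c : TorusWord n) {k : ℕ} (_ : n ≤ k) (ε : CircleSign),
    torusAug n c (Sum.inr (k, ε)) = 0
  | 0, _, _, _, _ => rfl
  | n + 1, Sum.inl c, k, h, ε => torusAug_of_le c (by omega) ε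
  | n + 1, Sum.inr t, k, h, ε => by
    have : k ≠ n := by omega
    simp [torusAug, this]

theorem torusAug_inl (z : TorusWord (n + 1) → ℤ) (q : CircleSign × CircleSign) :
    (z ᵥ* torusAug (n + 1)) (Sum.inl q) =
      ((fun c => z (Sum.inl c)) ᵥ* torusAug n) (Sum.inl q) := by
  simp [vecMul, dotProduct, sum_torusWord_succ, torusAug]

theorem torusAug_inr_last (z : TorusWord (n + 1) → ℤ) (ε : CircleSign) :
    (z ᵥ* torusAug (n + 1)) (Sum.inr (n, ε)) = ((fun t => z (Sum.inr t)) ᵥ* arcAug n) ε := by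
  simp [vecMul, dotProduct, sum_torusWord_succ, torusAug, torusAug_of_le]

theorem torusAug_inr_of_ne (z : TorusWord (n + 1) → ℤ) {k : ℕ} (h : k ≠ n) (ε : CircleSign) :
    (z ᵥ* torusAug (n + 1)) (Sum.inr (k, ε)) =
      ((fun c => z (Sum.inl c)) ᵥ* torusAug n) (Sum.inr (k, ε)) := by
  simp [vecMul, dotProduct, sum_torusWord_succ, torusAug, h]

theorem torusAug_inr_of_le (z : TorusWord n → ℤ) {k : ℕ} (h : n ≤ k) (ε : CircleSign) :
    (z ᵥ* torusAug n) (Sum.inr (k, ε)) = 0 := by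
  simp [vecMul, dotProduct, torusAug_of_le, h]

theorem torusAug_zero (z : TorusWord 0 → ℤ) (q : CircleSign × CircleSign) :
    (z ᵥ* torusAug 0) (Sum.inl q) = z q := by
  have h : ∀ y : CircleSign × CircleSign → ℤ, y ᵥ* (1 : Matrix _ _ ℤ) = y := vecMul_one
  exact congrFun (h z) q

end Components

/-! ### Chain maps and the retraction onto the reduced complex -/

section Identities

variable {m n : ℕ}

theorem arcWord_funext {f g : ArcWord (m + 1) → ℤ} (h₀ : ∀ t, f (t, none) = g (t, none))
    (h₁ : ∀ t, f (t, some plus) = g (t, some plus))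
    (h₂ : ∀ t, f (t, some minus) = g (t, some minus)) : f = g := by
  funext ⟨t, l⟩
  rcases l with _ | _ | _
  exacts [h₀ t, h₁ t, h₂ t]

theorem torusWord_funext {f g : TorusWord (n + 1) → ℤ} (h₀ : ∀ c, f (Sum.inl c) = g (Sum.inl c))
    (h₁ : ∀ t, f (Sum.inr t) = g (Sum.inr t)) : f = g := by
  funext c
  rcases c with c | t
  exacts [h₀ c, h₁ t]

theorem signX_signX (z : CircleSign → ℤ) : z ᵥ* signX ᵥ* signX = 0 := by
  funext ε
  cases ε
  · rw [vecMul_signX_plus, vecMul_signX_minus]; rfl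
  · rw [vecMul_signX_minus]; rfl

theorem lastX_lastX : ∀ {m : ℕ} (z : ArcWord m → ℤ), z ᵥ* lastX m ᵥ* lastX m = 0
  | 0, z => signX_signX z
  | m + 1, z => by
    refine arcWord_funext (fun t => ?_) (fun t => ?_) fun t => ?_
    · simp only [lastX_none]
      exact congrFun (lastX_lastX _) t
    · rw [lastX_plus, lastX_minus]; rfl
    · rw [lastX_minus]; rfl

theorem baseX_baseX : ∀ {m : ℕ} (z : ArcWord m → ℤ), z ᵥ* baseX m ᵥ* baseX m = 0
  | 0, z => signX_signX z
  | m + 1, z => by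
    funext ⟨t, l⟩
    simp only [baseX_apply]
    exact congrFun (baseX_baseX _) t

theorem lastX_baseX : ∀ {m : ℕ} (z : ArcWord m → ℤ),
    z ᵥ* lastX m ᵥ* baseX m = z ᵥ* baseX m ᵥ* lastX m
  | 0, z => rfl
  | m + 1, z => by
    refine arcWord_funext (fun t => ?_) (fun t => ?_) fun t => ?_
    · simp only [lastX_none, baseX_apply]
      exact congrFun (lastX_baseX _) t
    · simp only [lastX_plus, baseX_apply]
    · simp only [lastX_minus, baseX_apply]
      exact congrFun (zero_vecMul _) t

/-- Splitting is linear over multiplication by X; in the component of a `minus` on the new circle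
this comes down to X² = 0. -/
theorem arcDiff_lastX : ∀ {m : ℕ} (z : ArcWord m → ℤ),
    z ᵥ* arcDiff m ᵥ* lastX m = z ᵥ* lastX m ᵥ* arcDiff m
  | 0, z => by
    change z ᵥ* (0 : Matrix _ _ ℤ) ᵥ* _ = _ ᵥ* (0 : Matrix _ _ ℤ)
    simp only [vecMul_zero, zero_vecMul]
  | m + 1, z => by
    refine arcWord_funext (fun t => ?_) (fun t => ?_) fun t => ?_
    · simp only [lastX_none, arcDiff_none]
      exact congrFun (arcDiff_lastX _) t
    · simp only [lastX_plus, arcDiff_minus, arcDiff_plus, lastX_none]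
    · simp only [lastX_minus, arcDiff_minus, lastX_none]
      exact (sub_eq_zero.2 ((congrFun (lastX_lastX _) t).trans
        (congrFun (zero_vecMul _) t).symm)).symm

theorem arcDiff_baseX : ∀ {m : ℕ} (z : ArcWord m → ℤ),
    z ᵥ* arcDiff m ᵥ* baseX m = z ᵥ* baseX m ᵥ* arcDiff m
  | 0, z => by
    change z ᵥ* (0 : Matrix _ _ ℤ) ᵥ* _ = _ ᵥ* (0 : Matrix _ _ ℤ)
    simp only [vecMul_zero, zero_vecMul]
  | m + 1, z => by
    refine arcWord_funext (fun t => ?_) (fun t => ?_) fun t => ?_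
    · simp only [baseX_apply, arcDiff_none]
      exact congrFun (arcDiff_baseX _) t
    · simp only [baseX_apply, arcDiff_plus]
      rw [← arcDiff_baseX]
      exact congrFun (sub_vecMul _ _ _) t
    · simp only [baseX_apply, arcDiff_minus]
      rw [← arcDiff_baseX, ← lastX_baseX]
      exact congrFun (sub_vecMul _ _ _) t

theorem arcDiff_arcDiff : ∀ {m : ℕ} (z : ArcWord m → ℤ), z ᵥ* arcDiff m ᵥ* arcDiff m = 0
  | 0, z => vecMul_zero _
  | m + 1, z => by
    refine arcWord_funext (fun t => ?_) (fun t => ?_) fun t => ?_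
    · simp only [arcDiff_none]
      exact congrFun (arcDiff_arcDiff _) t
    · simp only [arcDiff_none, arcDiff_plus]
      refine sub_eq_zero.2 (Eq.symm ((congrFun (sub_vecMul _ _ _) t).trans ?_))
      simp only [Pi.sub_apply, arcDiff_arcDiff]
      exact sub_zero _
    · simp only [arcDiff_none, arcDiff_minus]
      refine sub_eq_zero.2 (Eq.symm ((congrFun (sub_vecMul _ _ _) t).trans ?_))
      simp only [Pi.sub_apply, arcDiff_arcDiff, arcDiff_lastX]
      exact sub_zero _

/-- The sign alternates because, in the cokernel of each splitting, X on the new circle is minus X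
on the circle before it. -/
theorem arcAug_lastX_plus : ∀ {m : ℕ} (z : ArcWord m → ℤ),
    (z ᵥ* lastX m ᵥ* arcAug m) plus = (-1) ^ m * (z ᵥ* arcAug m) minus
  | 0, z => by
    rw [arcAug_zero, arcAug_zero]
    exact (vecMul_signX_plus z).trans (by simp)
  | m + 1, z => by
    simp only [arcAug_plus, arcAug_minus, lastX_plus, lastX_minus]
    exact (congrArg (· + _) (congrFun (zero_vecMul _) _)).trans (zero_add _)

theorem arcAug_lastX_minus : ∀ {m : ℕ} (z : ArcWord m → ℤ), (z ᵥ* lastX m ᵥ* arcAug m) minus = 0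
  | 0, z => by
    rw [arcAug_zero]
    exact vecMul_signX_minus z
  | m + 1, z => by
    simp only [arcAug_minus, lastX_minus]
    exact congrFun (zero_vecMul _) _

theorem arcAug_baseX_minus : ∀ {m : ℕ} (z : ArcWord m → ℤ), (z ᵥ* baseX m ᵥ* arcAug m) minus = 0
  | 0, z => by
    rw [arcAug_zero]
    exact vecMul_signX_minus z
  | m + 1, z => by
    simp only [arcAug_minus, baseX_apply]
    exact arcAug_baseX_minus _

/-- The first circle is what remains when the kinks are removed, so no sign appears. The contrast
with `arcAug_lastX_plus` is the source of the coefficients 0 and 2. -/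
theorem arcAug_baseX_plus : ∀ {m : ℕ} (z : ArcWord m → ℤ),
    (z ᵥ* baseX m ᵥ* arcAug m) plus = (z ᵥ* arcAug m) minus
  | 0, z => by
    rw [arcAug_zero, arcAug_zero]
    exact vecMul_signX_plus z
  | m + 1, z => by
    simp only [arcAug_minus, arcAug_plus, baseX_apply, arcAug_baseX_minus, mul_zero, add_zero]
    exact arcAug_baseX_plus _

/-- The two terms t⊗X and Xt⊗1 of a splitting cancel under the retraction; the other terms vanish by
induction. -/
theorem arcAug_arcDiff : ∀ {m : ℕ} (z : ArcWord m → ℤ), z ᵥ* arcDiff m ᵥ* arcAug m = 0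
  | 0, z => (congrArg (· ᵥ* arcAug 0) (vecMul_zero z)).trans (zero_vecMul _)
  | m + 1, z => by
    have key : ∀ (x y : ArcWord m → ℤ) (ε : CircleSign),
        ((fun t => x t - (y ᵥ* arcDiff m) t) ᵥ* arcAug m) ε = (x ᵥ* arcAug m) ε := fun x y ε => by
      refine (congrFun (sub_vecMul _ _ _) ε).trans ?_
      rw [arcAug_arcDiff]
      exact sub_zero _
    funext ε
    cases ε
    · simp only [arcAug_plus, arcDiff_minus, arcDiff_plus, key, arcAug_lastX_plus]
      rw [pow_succ, Pi.zero_apply]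
      ring
    · simp only [arcAug_minus, arcDiff_minus, key, arcAug_lastX_minus]
      rfl

/-- The kernel of the retraction of a row of kinks is acyclic. -/
theorem exists_arcDiff_eq : ∀ {m : ℕ} (z : ArcWord m → ℤ), z ᵥ* arcDiff m = 0 →
    z ᵥ* arcAug m = 0 → ∃ y, y ᵥ* arcDiff m = z ∧ y ᵥ* arcAug m = 0
  | 0, z, _, h => by
    refine ⟨0, ?_, zero_vecMul _⟩
    rw [zero_vecMul]
    funext ε
    exact (congrFun h ε).symm.trans (arcAug_zero z ε)
  | m + 1, z, hd, hf => by
    have h₁ : ∀ t, z (t, none) = ((fun t => z (t, some plus)) ᵥ* arcDiff m) t := fun t => by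
      have := congrFun hd (t, some plus)
      rw [arcDiff_plus] at this
      exact sub_eq_zero.1 this
    have h₂ : (fun t => z (t, none)) ᵥ* lastX m = (fun t => z (t, some minus)) ᵥ* arcDiff m := by
      funext t
      have := congrFun hd (t, some minus)
      rw [arcDiff_minus] at this
      exact sub_eq_zero.1 this
    -- Write z₀, z₊, z₋ for the components of `z`. Then z₀ = d z₊ and X z₀ = d z₋, so X z₊ - z₋ is a
    -- cycle, and the retraction kills it because it kills `z`.
    rw [funext h₁, arcDiff_lastX] at h₂
    obtain ⟨y, hy, hy'⟩ := exists_arcDiff_eq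
      ((fun t => z (t, some plus)) ᵥ* lastX m - fun t => z (t, some minus))
      (by rw [sub_vecMul, h₂, sub_self]) (by
        rw [sub_vecMul]
        have hp := congrFun hf plus
        have hm := congrFun hf minus
        rw [arcAug_plus] at hp
        rw [arcAug_minus] at hm
        funext ε
        rw [Pi.zero_apply] at hp hm ⊢
        rw [Pi.sub_apply]
        cases ε
        · rw [arcAug_lastX_plus]
          rw [pow_succ] at hp
          linarith
        · rw [arcAug_lastX_minus, hm, sub_zero])
    -- The splitting sends z₊ to z₊⊗X + X z₊⊗1, and `y` corrects the second term to z₋.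
    refine ⟨fun p => match p with
      | (t, none) => z (t, some plus)
      | (_, some plus) => 0
      | (t, some minus) => y t, arcWord_funext (fun t => ?_) (fun t => ?_) fun t => ?_, ?_⟩
    · rw [arcDiff_none]
      exact (h₁ t).symm
    · rw [arcDiff_plus]
      exact (congrArg (_ - ·) (congrFun (zero_vecMul _) t)).trans (sub_zero _)
    · rw [arcDiff_minus]
      refine (congrArg (_ - ·) (congrFun hy t)).trans ?_
      exact sub_sub_cancel _ _
    · funext ε
      cases ε
      · rw [arcAug_plus]
        exact (congrArg₂ (fun p q => p + (-1) ^ (m + 1) * q) (congrFun hy' plus)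
          (congrFun (zero_vecMul _) minus)).trans (by simp)
      · rw [arcAug_minus]
        exact congrFun hy' minus

/-- After the additional crossing changes, the first and the last circle of the row are either the
two parts of a split circle or one and the same merged circle. X acts alike on both factors of a
comultiplication. -/
theorem closeUp_lastX : ∀ {n : ℕ} (z : TorusWord n → ℤ),
    z ᵥ* closeUp n ᵥ* lastX n = z ᵥ* closeUp n ᵥ* baseX n
  | 0, z => rfl
  | n + 1, z => by
    refine arcWord_funext (fun t => ?_) (fun t => ?_) fun t => ?_
    · simp only [lastX_none, baseX_apply, closeUp_none]
      exact congrFun (closeUp_lastX _) t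
    · simp only [lastX_plus, baseX_apply, closeUp_plus, closeUp_minus]
    · simp only [lastX_minus, baseX_apply, closeUp_minus]
      exact (congrFun (baseX_baseX _) t).symm

/-- This is what makes the cone a complex. `closeUp_lastX` is needed where the splittings at the
last two crossings meet. -/
theorem torusDiff_closeUp : ∀ {n : ℕ} (z : TorusWord n → ℤ),
    z ᵥ* torusDiff n ᵥ* closeUp n = z ᵥ* closeUp n ᵥ* arcDiff n
  | 0, z => (congrArg (· ᵥ* closeUp 0) (vecMul_zero z)).trans
      ((zero_vecMul _).trans (vecMul_zero _).symm)
  | n + 1, z => by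
    refine arcWord_funext (fun t => ?_) (fun t => ?_) fun t => ?_
    · simp only [closeUp_none, arcDiff_none, torusDiff_inl]
      exact congrFun (torusDiff_closeUp _) t
    · simp only [closeUp_plus, arcDiff_plus, torusDiff_inr, closeUp_none]
    · simp only [closeUp_minus, arcDiff_minus, torusDiff_inr, closeUp_none]
      refine (congrFun (sub_vecMul _ _ _) t).trans ?_
      rw [arcDiff_baseX, ← closeUp_lastX]
      rfl

theorem torusDiff_torusDiff : ∀ {n : ℕ} (z : TorusWord n → ℤ), z ᵥ* torusDiff n ᵥ* torusDiff n = 0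
  | 0, z => vecMul_zero _
  | n + 1, z => by
    refine torusWord_funext (fun t => ?_) fun t => ?_
    · simp only [torusDiff_inl]
      exact congrFun (torusDiff_torusDiff _) t
    · simp only [torusDiff_inl, torusDiff_inr]
      refine sub_eq_zero.2 (Eq.symm ((congrFun (sub_vecMul _ _ _) t).trans ?_))
      simp only [Pi.sub_apply, arcDiff_arcDiff, torusDiff_closeUp]
      exact sub_zero _

theorem reducedDiff_zero : reducedDiff n 0 = 0 := by
  funext i
  rcases i with _ | ⟨_ | k, _ | _⟩ <;> simp [reducedDiff]

/-- Without crossings `closeUp` is multiplication. Otherwise only words with marker B at the last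
crossing survive the retraction; their base circle splits, and the two terms give X and ±X, which
add or cancel by parity. -/
theorem arcAug_closeUp : ∀ {n : ℕ} (z : TorusWord n → ℤ) (ε : CircleSign),
    (z ᵥ* closeUp n ᵥ* arcAug n) ε =
      reducedDiff (n + 1) (z ᵥ* torusAug n) (Sum.inr (n, ε))
  | 0, z, ε => by
    rw [arcAug_zero]
    have h : ∀ ε, (z ᵥ* closeUp 0) ε =
        ∑ p : CircleSign × CircleSign, z p * closeUp 0 p ε := fun _ => rfl
    refine (h ε).trans ?_
    rw [Fintype.sum_prod_type]
    cases ε <;>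
      simp [sum_circleSign, closeUp, reducedDiff, torusAug_zero]
  | n + 1, z, minus => by
    rw [arcAug_minus]
    simp only [closeUp_minus]
    exact arcAug_baseX_minus _
  | n + 1, z, plus => by
    rw [arcAug_plus]
    simp only [closeUp_minus, closeUp_plus]
    refine (congrArg (· + _) (arcAug_baseX_plus _)).trans ?_
    rw [reducedDiff, torusAug_inr_last]
    rcases Nat.even_or_odd n with h | h
    · rw [if_neg fun h' => Nat.not_odd_iff_even.2 h h'.2, h.add_one.neg_one_pow]
      ring
    · rw [if_pos ⟨by omega, h⟩, h.add_one.neg_one_pow]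
      ring

theorem reducedDiff_inr_of_lt {x y : Reduced → ℤ} {k : ℕ} (hk : k < n)
    (h : ∀ q, x (Sum.inl q) = y (Sum.inl q))
    (h' : ∀ j < k, ∀ ε, x (Sum.inr (j, ε)) = y (Sum.inr (j, ε))) (ε : CircleSign) :
    reducedDiff (n + 1) x (Sum.inr (k, ε)) = reducedDiff n y (Sum.inr (k, ε)) := by
  rcases k with _ | k <;> cases ε <;> simp [reducedDiff, h, h', hk, hk.le]

theorem torusAug_torusDiff : ∀ {n : ℕ} (z : TorusWord n → ℤ),
    z ᵥ* torusDiff n ᵥ* torusAug n = reducedDiff n (z ᵥ* torusAug n)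
  | 0, z => by
    refine (congrArg (· ᵥ* torusAug 0) (vecMul_zero z)).trans ((zero_vecMul _).trans ?_)
    funext i
    rcases i with _ | ⟨_ | k, _ | _⟩ <;> simp [reducedDiff]
  | n + 1, z => by
    have ih := torusAug_torusDiff fun c => z (Sum.inl c)
    funext i
    rcases i with q | ⟨k, ε⟩
    · rw [torusAug_inl]
      simp only [torusDiff_inl]
      exact congrFun ih (Sum.inl q)
    · rcases lt_trichotomy k n with hk | rfl | hk
      · rw [torusAug_inr_of_ne _ hk.ne]
        simp only [torusDiff_inl]
        refine (congrFun ih (Sum.inr (k, ε))).trans (Eq.symm ?_)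
        exact reducedDiff_inr_of_lt hk (torusAug_inl z)
          (fun j hj => torusAug_inr_of_ne z (hj.trans hk).ne) ε
      · rw [torusAug_inr_last]
        simp only [torusDiff_inr]
        refine (congrFun (sub_vecMul _ _ _) ε).trans ?_
        rw [Pi.sub_apply, arcAug_closeUp, arcAug_arcDiff, Pi.zero_apply, sub_zero]
        rcases k with _ | k <;> cases ε <;>
          simp [reducedDiff, torusAug_inl, torusAug_inr_of_ne]
      · rw [torusAug_inr_of_le _ hk]
        rcases k with _ | k <;> cases ε <;> simp [reducedDiff]
        all_goals omega

/-- The kernel of the retraction of the complex of the closed braid is acyclic. -/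
theorem exists_torusDiff_eq : ∀ {n : ℕ} (z : TorusWord n → ℤ), z ᵥ* torusDiff n = 0 →
    z ᵥ* torusAug n = 0 → ∃ y, y ᵥ* torusDiff n = z ∧ y ᵥ* torusAug n = 0
  | 0, z, _, h => by
    refine ⟨0, ?_, zero_vecMul _⟩
    rw [zero_vecMul]
    funext q
    exact (congrFun h (Sum.inl q)).symm.trans (torusAug_zero z q)
  | n + 1, z, hd, hf => by
    obtain ⟨y, hy, hy'⟩ := exists_torusDiff_eq (fun c => z (Sum.inl c))
      (funext fun c => (torusDiff_inl z c).symm.trans (congrFun hd _))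
      (funext fun i => by
        rcases i with q | ⟨k, ε⟩
        · rw [← torusAug_inl, hf, Pi.zero_apply]
        · by_cases hk : k = n
          · exact torusAug_inr_of_le _ hk.ge ε
          · rw [← torusAug_inr_of_ne _ hk, hf, Pi.zero_apply])
    have hd' : (fun t => z (Sum.inr t)) ᵥ* arcDiff n = (fun c => z (Sum.inl c)) ᵥ* closeUp n := by
      funext t
      have := congrFun hd (Sum.inr t)
      rw [torusDiff_inr] at this
      exact (sub_eq_zero.1 this).symm
    have hq : ∀ ε, (y ᵥ* closeUp n ᵥ* arcAug n) ε = 0 := fun ε => by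
      rw [arcAug_closeUp, hy', reducedDiff_zero, Pi.zero_apply]
    -- In the cone, once `y` bounds the first component, the error in the second is a cycle since
    -- `closeUp` is a chain map; the retraction kills it since it kills `y` and `z`.
    obtain ⟨x, hx, hx'⟩ := exists_arcDiff_eq (y ᵥ* closeUp n - fun t => z (Sum.inr t))
      (by rw [sub_vecMul, hd', ← torusDiff_closeUp, hy, sub_self])
      (by
        rw [sub_vecMul]
        funext ε
        rw [Pi.sub_apply, hq, ← torusAug_inr_last, hf]
        rfl)
    refine ⟨fun p => match p with
      | Sum.inl c => y c
      | Sum.inr t => x t, torusWord_funext (fun c => ?_) (fun t => ?_), ?_⟩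
    · rw [torusDiff_inl]
      exact congrFun hy c
    · rw [torusDiff_inr]
      exact (congrArg (_ - ·) (congrFun hx t)).trans (sub_sub_cancel _ _)
    · funext i
      rcases i with q | ⟨k, ε⟩
      · rw [torusAug_inl]
        exact congrFun hy' _
      · by_cases hk : k = n
        · subst hk
          rw [torusAug_inr_last]
          exact congrFun hx' ε
        · rw [torusAug_inr_of_ne _ hk]
          exact congrFun hy' _

theorem exists_arcAug_eq : ∀ {m : ℕ} (y : CircleSign → ℤ), ∃ z, z ᵥ* arcAug m = y
  | 0, y => ⟨(y : CircleSign → ℤ), funext fun ε => arcAug_zero _ ε⟩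
  | m + 1, y => by
    obtain ⟨z, rfl⟩ := exists_arcAug_eq (m := m) y
    refine ⟨fun p => match p with
      | (t, some minus) => z t
      | _ => 0, funext fun ε => ?_⟩
    cases ε
    · rw [arcAug_plus]
      exact (congrArg (fun q => _ + (-1) ^ (m + 1) * q) (congrFun (zero_vecMul _) minus)).trans
        (by simp)
    · rw [arcAug_minus]

theorem exists_torusAug_eq : ∀ {n : ℕ} (x : Reduced → ℤ)
    (_ : ∀ k, n ≤ k → ∀ ε, x (Sum.inr (k, ε)) = 0), ∃ z, z ᵥ* torusAug n = x
  | 0, x, h => ⟨fun q => x (Sum.inl q), funext fun i => by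
      rcases i with q | ⟨k, ε⟩
      · exact torusAug_zero _ q
      · rw [torusAug_inr_of_le _ (Nat.zero_le k), h _ (Nat.zero_le k)]⟩
  | n + 1, x, h => by
    obtain ⟨z, hz⟩ := exists_torusAug_eq (n := n)
      (fun i => match i with
        | Sum.inl q => x (Sum.inl q)
        | Sum.inr (k, ε) => if k = n then 0 else x (Sum.inr (k, ε)))
      (fun k hk ε => by
        by_cases hk' : k = n
        · simp [hk']
        · simpa [hk'] using h k (by omega) ε)
    obtain ⟨y, hy⟩ := exists_arcAug_eq (m := n) fun ε => x (Sum.inr (n, ε))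
    refine ⟨fun p => match p with
      | Sum.inl c => z c
      | Sum.inr t => y t, funext fun i => ?_⟩
    rcases i with q | ⟨k, ε⟩
    · rw [torusAug_inl]
      exact congrFun hz (Sum.inl q)
    · by_cases hk : k = n
      · subst hk
        rw [torusAug_inr_last]
        exact congrFun hy ε
      · rw [torusAug_inr_of_ne _ hk]
        exact (congrFun hz (Sum.inr (k, ε))).trans (if_neg hk)

end Identities

/-! ### Letters, gradings and incidence of words -/

/-- The letter at the place `i` of a row of kinks. -/
def arcLetter : ∀ {m : ℕ}, ArcWord m → ℕ → Option CircleSign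
  | 0, _, _ => none
  | m + 1, p, i => if i = m then p.2 else arcLetter p.1 i

/-- The sign of the circle that starts a row of kinks. -/
def arcBase : ∀ {m : ℕ}, ArcWord m → CircleSign
  | 0, ε => ε
  | _ + 1, p => arcBase p.1

/-- The letter at the crossing `i` of the closed braid: the sign of the circle above it if its
marker is `B`. -/
def torusLetter : ∀ {n : ℕ}, TorusWord n → ℕ → Option CircleSign
  | 0, _, _ => none
  | _ + 1, Sum.inl c, i => torusLetter c i
  | n + 1, Sum.inr t, i => if i = n then some (arcBase t) else arcLetter t i

/-- The signs of the two strands of the closed braid, if all markers are `A`. -/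
def torusPair : ∀ {n : ℕ}, TorusWord n → Option (CircleSign × CircleSign)
  | 0, p => some p
  | _ + 1, Sum.inl c => torusPair c
  | _ + 1, Sum.inr _ => none

/-- A sign as an integer. -/
def signVal : CircleSign → ℤ
  | plus => 1
  | minus => -1

/-- The contribution of a letter to `σ`. -/
def letterSigma : Option CircleSign → ℤ
  | none => 1
  | some _ => -1

/-- The contribution of a letter to `τ`. -/
def letterTau : Option CircleSign → ℤ
  | none => 0
  | some ε => signVal ε

/-- `σ` for a row of kinks. -/
def arcSigma : ∀ {m : ℕ}, ArcWord m → ℤ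
  | 0, _ => 0
  | _ + 1, p => arcSigma p.1 + letterSigma p.2

/-- `τ` for a row of kinks. -/
def arcTau : ∀ {m : ℕ}, ArcWord m → ℤ
  | 0, ε => signVal ε
  | _ + 1, p => arcTau p.1 + letterTau p.2

/-- `σ` for a closed braid. -/
def torusSigma : ∀ {n : ℕ}, TorusWord n → ℤ
  | 0, _ => 0
  | _ + 1, Sum.inl c => torusSigma c + 1
  | _ + 1, Sum.inr t => arcSigma t - 1

/-- `τ` for a closed braid. -/
def torusTau : ∀ {n : ℕ}, TorusWord n → ℤ
  | 0, p => signVal p.1 + signVal p.2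
  | _ + 1, Sum.inl c => torusTau c
  | _ + 1, Sum.inr t => arcTau t

/-- The last place before `j` that carries a sign. -/
def lastMark (w : ℕ → Option CircleSign) : ℕ → Option ℕ
  | 0 => none
  | j + 1 => if (w j).isSome then some j else lastMark w j

/-- The last place cyclically before `j`, among `n` places, that carries a sign. -/
def cyclicMark (n : ℕ) (w : ℕ → Option CircleSign) (j : ℕ) : Option ℕ :=
  (lastMark w j).or (lastMark w n)

/-- Incidence of rows of kinks at `v`. -/
def ArcIncident {m : ℕ} (v : ℕ) (t t' : ArcWord m) : Prop :=
  arcLetter t v = none ∧ (arcLetter t' v).isSome ∧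
    (∀ u, u ≠ v → (arcLetter t u).isSome = (arcLetter t' u).isSome) ∧
    arcTau t' = arcTau t + 1 ∧
    (∀ u, u ≠ v → lastMark (arcLetter t) v ≠ some u → arcLetter t u = arcLetter t' u) ∧
    (lastMark (arcLetter t) v ≠ none → arcBase t = arcBase t')

/-- Incidence of states of the closed braid at `v`. -/
def TorusIncident {n : ℕ} (v : ℕ) (c c' : TorusWord n) : Prop :=
  torusLetter c v = none ∧ (torusLetter c' v).isSome ∧
    (∀ u, u ≠ v → (torusLetter c u).isSome = (torusLetter c' u).isSome) ∧
    torusTau c' = torusTau c + 1 ∧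
    (∀ u, u ≠ v → cyclicMark n (torusLetter c) v ≠ some u → torusLetter c u = torusLetter c' u)

/-- Rows of kinks that agree up to the sign of the last circle. -/
def ArcAgree {m : ℕ} (t t' : ArcWord m) : Prop :=
  (∀ u, (arcLetter t u).isSome = (arcLetter t' u).isSome) ∧
    (∀ u, lastMark (arcLetter t) m ≠ some u → arcLetter t u = arcLetter t' u) ∧
    (lastMark (arcLetter t) m ≠ none → arcBase t = arcBase t')

/-- The number of places after `v`, among `n` places, that carry a sign. -/
def marksAfter (n : ℕ) (w : ℕ → Option CircleSign) (v : ℕ) : ℕ :=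
  ((Finset.range n).filter fun u => v < u ∧ (w u).isSome).card

/-- The row of kinks `t` arises from the state `c` by a change at an additional last crossing, up to
the signs of the circles there. -/
def TorusAgree {n : ℕ} (c : TorusWord n) (t : ArcWord n) : Prop :=
  (∀ u, (torusLetter c u).isSome = (arcLetter t u).isSome) ∧
    ∀ u, lastMark (torusLetter c) n ≠ some u → torusLetter c u = arcLetter t u

/-! ### Matrix entries as signed incidence numbers -/

section Letters

variable {m n : ℕ}

theorem lastMark_congr {w w' : ℕ → Option CircleSign} :
    ∀ {j : ℕ}, (∀ i < j, w i = w' i) → lastMark w j = lastMark w' j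
  | 0, _ => rfl
  | j + 1, h => by
    rw [lastMark, lastMark, h j j.lt_succ_self,
      lastMark_congr fun i hi => h i (hi.trans j.lt_succ_self)]

theorem lastMark_lt {w : ℕ → Option CircleSign} : ∀ {j u : ℕ}, lastMark w j = some u → u < j
  | j + 1, u, h => by
    rw [lastMark] at h
    split_ifs at h
    · obtain rfl := Option.some.inj h
      exact Nat.lt_succ_self _
    · exact (lastMark_lt h).trans j.lt_succ_self

theorem arcLetter_of_le : ∀ {m : ℕ} (t : ArcWord m) {i : ℕ}, m ≤ i → arcLetter t i = none
  | 0, _, _, _ => rfl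
  | m + 1, p, i, h => by
    rw [arcLetter, if_neg (by omega)]
    exact arcLetter_of_le p.1 (by omega)

theorem torusLetter_of_le : ∀ {n : ℕ} (c : TorusWord n) {i : ℕ}, n ≤ i → torusLetter c i = none
  | 0, _, _, _ => rfl
  | n + 1, Sum.inl c, i, h => torusLetter_of_le c (by omega)
  | n + 1, Sum.inr t, i, h => by
    rw [torusLetter, if_neg (by omega)]
    exact arcLetter_of_le t (by omega)

theorem arcLetter_last (p : ArcWord (m + 1)) : arcLetter p m = p.2 := if_pos rfl

theorem arcLetter_of_ne (p : ArcWord (m + 1)) {i : ℕ} (h : i ≠ m) :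
    arcLetter p i = arcLetter p.1 i := if_neg h

theorem torusLetter_inr_last (t : ArcWord n) :
    torusLetter (n := n + 1) (Sum.inr t) n = some (arcBase t) := if_pos rfl

theorem torusLetter_inr_of_ne (t : ArcWord n) {i : ℕ} (h : i ≠ n) :
    torusLetter (n := n + 1) (Sum.inr t) i = arcLetter t i := if_neg h

theorem torusLetter_inl (c : TorusWord n) (i : ℕ) :
    torusLetter (n := n + 1) (Sum.inl c) i = torusLetter c i := rfl

theorem arcWord_ext : ∀ {m : ℕ} {t t' : ArcWord m},
    (∀ i, arcLetter t i = arcLetter t' i) → arcBase t = arcBase t' → t = t'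
  | 0, _, _, _, h => h
  | m + 1, p, p', h, hb => by
    refine Prod.ext (arcWord_ext (fun i => ?_) hb) ?_
    · by_cases hi : i = m
      · rw [hi, arcLetter_of_le _ le_rfl, arcLetter_of_le _ le_rfl]
      · rw [← arcLetter_of_ne p hi, h, arcLetter_of_ne p' hi]
    · rw [← arcLetter_last p, h, arcLetter_last p']

theorem lastMark_arcLetter (p : ArcWord (m + 1)) {v : ℕ} (h : v ≤ m) :
    lastMark (arcLetter p) v = lastMark (arcLetter p.1) v :=
  lastMark_congr fun _ hi => arcLetter_of_ne p (hi.trans_le h).ne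

theorem signVal_injective : Function.Injective signVal := by
  rintro (_ | _) (_ | _) <;> simp [signVal]

theorem arcTau_sub_signVal : ∀ {m : ℕ} {t t' : ArcWord m},
    (∀ i, arcLetter t i = arcLetter t' i) →
      arcTau t' - signVal (arcBase t') = arcTau t - signVal (arcBase t)
  | 0, ε, ε', _ => (sub_self (signVal ε')).trans (sub_self (signVal ε)).symm
  | m + 1, p, p', h => by
    have h₁ := arcTau_sub_signVal (t := p.1) (t' := p'.1) fun i => by
      by_cases hi : i = m
      · rw [hi, arcLetter_of_le _ le_rfl, arcLetter_of_le _ le_rfl]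
      · rw [← arcLetter_of_ne p hi, h, arcLetter_of_ne p' hi]
    have h₂ := h m
    rw [arcLetter_last, arcLetter_last] at h₂
    rw [arcTau, arcTau, arcBase, arcBase, h₂]
    linarith

theorem arcAgree_refl (t : ArcWord m) : ArcAgree t t := ⟨fun _ => rfl, fun _ _ => rfl, fun _ => rfl⟩

theorem arcAgree_none {p p' : ArcWord (m + 1)} (h : p.2 = none) (h' : p'.2 = none) :
    ArcAgree p p' ↔ ArcAgree p.1 p'.1 := by
  have hl : ∀ q : ArcWord (m + 1), q.2 = none → arcLetter q = arcLetter q.1 := fun q hq => by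
    funext i
    by_cases hi : i = m
    · rw [hi, arcLetter_last, arcLetter_of_le _ le_rfl, hq]
    · exact arcLetter_of_ne _ hi
  have hm : lastMark (arcLetter p.1) (m + 1) = lastMark (arcLetter p.1) m := by
    rw [lastMark, arcLetter_of_le _ le_rfl]
    rfl
  unfold ArcAgree
  rw [hl p h, hl p' h', hm]
  rfl

theorem arcAgree_some {p p' : ArcWord (m + 1)} (h₀ : p.2.isSome) (h₀' : p'.2.isSome) :
    ArcAgree p p' ↔ p.1 = p'.1 := by
  have hm : lastMark (arcLetter p) (m + 1) = some m := by
    rw [lastMark, arcLetter_last, if_pos h₀]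
  unfold ArcAgree
  rw [hm]
  constructor
  · rintro ⟨-, h, h'⟩
    refine arcWord_ext (fun i => ?_) (h' (by simp))
    by_cases hi : i = m
    · rw [hi, arcLetter_of_le _ le_rfl, arcLetter_of_le _ le_rfl]
    · have := h i fun h => hi (Option.some.inj h).symm
      rwa [arcLetter_of_ne _ hi, arcLetter_of_ne _ hi] at this
  · intro h
    refine ⟨fun i => ?_, fun i hi => ?_, fun _ => congrArg (arcBase (m := m)) h⟩
    · by_cases hi : i = m
      · rw [hi, arcLetter_last, arcLetter_last, h₀, h₀']
      · rw [arcLetter_of_ne _ hi, arcLetter_of_ne _ hi, h]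
    · have : i ≠ m := fun h => hi (by rw [h])
      rw [arcLetter_of_ne _ this, arcLetter_of_ne _ this, h]

theorem ArcAgree.isSome_eq {p p' : ArcWord (m + 1)} (h : ArcAgree p p') :
    p.2.isSome = p'.2.isSome := by
  have := h.1 m
  rwa [arcLetter_last, arcLetter_last] at this

/-- Only the sign of the last circle is free, and τ determines it. -/
theorem arcAgree_and_arcTau_eq : ∀ {m : ℕ} {t t' : ArcWord m},
    ArcAgree t t' ∧ arcTau t' = arcTau t ↔ t = t'
  | 0, t, t' => ⟨fun h => (signVal_injective h.2).symm, fun h => h ▸ ⟨arcAgree_refl _, rfl⟩⟩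
  | m + 1, p, p' => by
    refine ⟨fun ⟨h, h'⟩ => ?_, fun h => h ▸ ⟨arcAgree_refl _, rfl⟩⟩
    rw [arcTau, arcTau] at h'
    have hs := h.isSome_eq
    rcases hp : p.2 with _ | ε <;> rcases hp' : p'.2 with _ | ε' <;> rw [hp, hp'] at hs h'
    · rw [arcAgree_none hp hp'] at h
      exact Prod.ext (arcAgree_and_arcTau_eq.1 ⟨h, add_right_cancel h'⟩) (hp.trans hp'.symm)
    · cases hs
    · cases hs
    · rw [arcAgree_some (by rw [hp]; rfl) (by rw [hp']; rfl)] at h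
      rw [h] at h'
      have : ε' = ε := signVal_injective (add_left_cancel h')
      exact Prod.ext h (hp.trans (this ▸ hp'.symm))

-- With one sign free, a rise of τ by two can only be a change from `minus` to `plus`, which is
-- multiplication by X.
open Classical in
theorem lastX_eq_ite : ∀ {m : ℕ} (t t' : ArcWord m),
    lastX m t t' = if ArcAgree t t' ∧ arcTau t' = arcTau t + 2 then 1 else 0
  | 0, t, t' => by
    have : ArcAgree t t' := ⟨fun _ => rfl, fun _ _ => rfl, fun h => absurd rfl h⟩
    simp only [this]
    rcases t with _ | _ <;> rcases t' with _ | _ <;> simp [lastX, signX, arcTau, signVal]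
  | m + 1, p, p' => by
    by_cases hs : p.2.isSome = p'.2.isSome
    · by_cases hp : p.2.isSome
      · rw [arcAgree_some hp (hs ▸ hp)]
        obtain ⟨t, l⟩ := p
        obtain ⟨t', l'⟩ := p'
        by_cases h : t = t'
        · subst h
          rcases l with _ | _ | _ <;> rcases l' with _ | _ | _ <;>
            simp_all [lastX, arcTau, letterTau, signVal, add_assoc]
        · rcases l with _ | _ | _ <;> rcases l' with _ | _ | _ <;> simp_all [lastX]
      · have hp₀ : p.2 = none := by simpa using hp
        have hp' : p'.2 = none := by rw [hs] at hp; simpa using hp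
        rw [arcAgree_none hp₀ hp', arcTau, arcTau, hp₀, hp', letterTau, add_zero, add_zero,
          ← lastX_eq_ite]
        obtain ⟨t, l⟩ := p
        obtain ⟨t', l'⟩ := p'
        obtain rfl : l = none := hp₀
        obtain rfl : l' = none := hp'
        rfl
    · rw [if_neg fun h => hs h.1.isSome_eq]
      obtain ⟨t, l⟩ := p
      obtain ⟨t', l'⟩ := p'
      rcases l with _ | _ | _ <;> rcases l' with _ | _ | _ <;> first | rfl | exact absurd rfl hs

theorem arcLetter_eq_iff {p p' : ArcWord (m + 1)} :
    (∀ i, arcLetter p i = arcLetter p' i) ↔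
      p.2 = p'.2 ∧ ∀ i, arcLetter p.1 i = arcLetter p'.1 i := by
  constructor
  · intro h
    refine ⟨by rw [← arcLetter_last, h, arcLetter_last], fun i => ?_⟩
    by_cases hi : i = m
    · rw [hi, arcLetter_of_le _ le_rfl, arcLetter_of_le _ le_rfl]
    · simpa only [arcLetter_of_ne _ hi] using h i
  · rintro ⟨hl, h⟩ i
    by_cases hi : i = m
    · rw [hi, arcLetter_last, arcLetter_last, hl]
    · simpa only [arcLetter_of_ne _ hi] using h i

open Classical in
theorem baseX_eq_ite : ∀ {m : ℕ} (t t' : ArcWord m),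
    baseX m t t' = if (∀ i, arcLetter t i = arcLetter t' i) ∧ arcTau t' = arcTau t + 2
      then 1 else 0
  | 0, t, t' => by
    have : ∀ i, arcLetter t i = arcLetter t' i := fun i => rfl
    simp only [this]
    rcases t with _ | _ <;> rcases t' with _ | _ <;> simp [baseX, signX, arcTau, signVal]
  | m + 1, p, p' => by
    rw [arcLetter_eq_iff, arcTau, arcTau]
    by_cases hl : p.2 = p'.2
    · refine (if_pos hl).trans ?_
      rw [baseX_eq_ite, hl]
      congr 1
      exact propext ⟨fun h => ⟨⟨rfl, h.1⟩, by linarith [h.2]⟩, fun h => ⟨h.1.2, by linarith [h.2]⟩⟩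
    · rw [if_neg fun h => hl h.1.1]
      exact if_neg hl

theorem marksAfter_succ (w : ℕ → Option CircleSign) {v : ℕ} (h : v < n) :
    marksAfter (n + 1) w v = marksAfter n w v + if (w n).isSome then 1 else 0 := by
  unfold marksAfter
  rw [Finset.range_add_one, Finset.filter_insert]
  split_ifs with h₁ h₂ h₂
  · rw [Finset.card_insert_of_notMem (by simp)]
  · exact absurd h₁.2 h₂
  · exact absurd ⟨h, h₂⟩ h₁
  · rfl

theorem marksAfter_last (w : ℕ → Option CircleSign) : marksAfter (n + 1) w n = 0 := by
  unfold marksAfter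
  rw [Finset.card_eq_zero, Finset.filter_eq_empty_iff]
  intro u hu h
  have := Finset.mem_range.1 hu
  omega

theorem marksAfter_congr {w w' : ℕ → Option CircleSign} {v : ℕ} (h : ∀ i < n, w i = w' i) :
    marksAfter n w v = marksAfter n w' v := by
  unfold marksAfter
  congr 1
  refine Finset.filter_congr fun u hu => ?_
  rw [h u (Finset.mem_range.1 hu)]

/-- The circle that is split at `v` starts before `v`, hence not at the last kink, whose letter must
persist. -/
theorem arcIncident_of_lt {v : ℕ} (hv : v < m) {p p' : ArcWord (m + 1)} :
    ArcIncident v p p' ↔ p.2 = p'.2 ∧ ArcIncident v p.1 p'.1 := by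
  unfold ArcIncident
  rw [arcLetter_of_ne _ hv.ne, arcLetter_of_ne _ hv.ne, lastMark_arcLetter _ hv.le, arcTau, arcTau,
    arcBase, arcBase]
  constructor
  · rintro ⟨h₁, h₂, h₃, h₄, h₅, h₆⟩
    have hl : p.2 = p'.2 := by
      rw [← arcLetter_last p, ← arcLetter_last p']
      exact h₅ m hv.ne' fun h => (lastMark_lt h).not_gt hv
    refine ⟨hl, h₁, h₂, fun u hu => ?_, ?_, fun u hu hu' => ?_, h₆⟩
    · by_cases hi : u = m
      · rw [hi, arcLetter_of_le _ le_rfl, arcLetter_of_le _ le_rfl]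
      · simpa only [arcLetter_of_ne _ hi] using h₃ u hu
    · rw [hl] at h₄
      linarith
    · by_cases hi : u = m
      · rw [hi, arcLetter_of_le _ le_rfl, arcLetter_of_le _ le_rfl]
      · simpa only [arcLetter_of_ne _ hi] using h₅ u hu hu'
  · rintro ⟨hl, h₁, h₂, h₃, h₄, h₅, h₆⟩
    refine ⟨h₁, h₂, fun u hu => ?_, ?_, fun u hu hu' => ?_, h₆⟩
    · by_cases hi : u = m
      · rw [hi, arcLetter_last, arcLetter_last, hl]
      · simpa only [arcLetter_of_ne _ hi] using h₃ u hu
    · rw [hl]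
      linarith
    · by_cases hi : u = m
      · rw [hi, arcLetter_last, arcLetter_last, hl]
      · simpa only [arcLetter_of_ne _ hi] using h₅ u hu hu'

theorem arcIncident_last {p p' : ArcWord (m + 1)} :
    ArcIncident m p p' ↔ p.2 = none ∧ p'.2.isSome ∧ ArcAgree p.1 p'.1 ∧
      arcTau p'.1 + letterTau p'.2 = arcTau p.1 + 1 := by
  unfold ArcIncident ArcAgree
  rw [arcLetter_last, arcLetter_last, lastMark_arcLetter _ le_rfl, arcTau, arcTau, arcBase, arcBase]
  constructor
  · rintro ⟨h₁, h₂, h₃, h₄, h₅, h₆⟩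
    refine ⟨h₁, h₂, ⟨fun u => ?_, fun u hu => ?_, h₆⟩, by simpa [h₁, letterTau] using h₄⟩
    · by_cases hi : u = m
      · rw [hi, arcLetter_of_le _ le_rfl, arcLetter_of_le _ le_rfl]
      · simpa only [arcLetter_of_ne _ hi] using h₃ u hi
    · by_cases hi : u = m
      · rw [hi, arcLetter_of_le _ le_rfl, arcLetter_of_le _ le_rfl]
      · simpa only [arcLetter_of_ne _ hi] using h₅ u hi hu
  · rintro ⟨h₁, h₂, ⟨h₃, h₅, h₆⟩, h₄⟩
    refine ⟨h₁, h₂, fun u hi => ?_, by simpa [h₁, letterTau] using h₄, fun u hi hu => ?_, h₆⟩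
    · simpa only [arcLetter_of_ne _ hi] using h₃ u
    · simpa only [arcLetter_of_ne _ hi] using h₅ u hu

-- A sign on the last kink multiplies all earlier terms by -1. In the term of the last kink, a new
-- `plus` leaves τ of the rest unchanged, hence the rest itself; a new `minus` forces τ of the rest
-- up by two, which is `lastX`.
open Classical in
theorem arcDiff_eq_sum : ∀ {m : ℕ} (t t' : ArcWord m), arcDiff m t t' =
    ∑ v ∈ Finset.range m, if ArcIncident v t t' then (-1) ^ marksAfter m (arcLetter t) v else 0
  | 0, _, _ => rfl
  | m + 1, p, p' => by
    rw [Finset.sum_range_succ]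
    have h : ∀ v ∈ Finset.range m,
        (if ArcIncident v p p' then (-1 : ℤ) ^ marksAfter (m + 1) (arcLetter p) v else 0) =
          (if p.2 = p'.2 then (if p.2.isSome then -1 else 1) else 0) *
            if ArcIncident v p.1 p'.1 then (-1) ^ marksAfter m (arcLetter p.1) v else 0 := by
      intro v hv
      have hv := Finset.mem_range.1 hv
      rw [arcIncident_of_lt hv, marksAfter_succ _ hv, arcLetter_last,
        marksAfter_congr fun i hi => arcLetter_of_ne p hi.ne]
      by_cases h₁ : p.2 = p'.2
      · by_cases h₂ : ArcIncident v p.1 p'.1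
        · rw [if_pos ⟨h₁, h₂⟩, if_pos h₁, if_pos h₂]
          by_cases h₃ : p.2.isSome = true
          · rw [if_pos h₃, if_pos h₃, pow_succ]
            ring
          · rw [if_neg h₃, if_neg h₃, add_zero, one_mul]
        · rw [if_neg fun h => h₂ h.2, if_neg h₂, mul_zero]
      · rw [if_neg fun h => h₁ h.1, if_neg h₁, zero_mul]
    rw [Finset.sum_congr rfl h, ← Finset.mul_sum, ← arcDiff_eq_sum, arcIncident_last,
      marksAfter_last]
    obtain ⟨t, l⟩ := p
    obtain ⟨t', l'⟩ := p'
    rcases l with _ | ε <;> rcases l' with _ | _ | _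
    · simp [arcDiff]
    · have : ∀ a b : ℤ, a + 1 = b + 1 ↔ a = b := fun a b => by omega
      simp [arcDiff, letterTau, signVal, this, arcAgree_and_arcTau_eq]
    · have : ∀ a b : ℤ, a + -1 = b + 1 ↔ a = b + 2 := fun a b => by omega
      simp [arcDiff, letterTau, signVal, this, lastX_eq_ite]
    · simp [arcDiff]
    · simp [arcDiff]
    · simp [arcDiff]

theorem torusAgree_inl {c : TorusWord n} {p : ArcWord (n + 1)} :
    TorusAgree (n := n + 1) (Sum.inl c) p ↔ p.2 = none ∧ TorusAgree c p.1 := by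
  have hm : lastMark (torusLetter (n := n + 1) (Sum.inl c)) (n + 1) =
      lastMark (torusLetter c) n := by
    rw [lastMark, torusLetter_inl, torusLetter_of_le _ le_rfl]
    rfl
  unfold TorusAgree
  simp only [hm, torusLetter_inl]
  constructor
  · rintro ⟨h₁, h₂⟩
    have hp : p.2 = none := by
      have := h₁ n
      rw [torusLetter_of_le _ le_rfl, arcLetter_last] at this
      simpa using this.symm
    refine ⟨hp, fun u => ?_, fun u hu => ?_⟩
    · by_cases hi : u = n
      · rw [hi, arcLetter_of_le _ le_rfl, torusLetter_of_le _ le_rfl]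
      · rw [h₁, arcLetter_of_ne _ hi]
    · by_cases hi : u = n
      · rw [hi, arcLetter_of_le _ le_rfl, torusLetter_of_le _ le_rfl]
      · rw [h₂ u hu, arcLetter_of_ne _ hi]
  · rintro ⟨hp, h₁, h₂⟩
    refine ⟨fun u => ?_, fun u hu => ?_⟩
    · by_cases hi : u = n
      · rw [hi, arcLetter_last, torusLetter_of_le _ le_rfl, hp]
      · rw [h₁, arcLetter_of_ne _ hi]
    · by_cases hi : u = n
      · rw [hi, arcLetter_last, torusLetter_of_le _ le_rfl, hp]
      · rw [h₂ u hu, arcLetter_of_ne _ hi]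

/-- The circle to be split starts at place `n`, so the sign there and the base sign of `p` are both
free. -/
theorem torusAgree_inr {t : ArcWord n} {p : ArcWord (n + 1)} :
    TorusAgree (n := n + 1) (Sum.inr t) p ↔
      p.2.isSome ∧ ∀ i, arcLetter t i = arcLetter p.1 i := by
  have hm : lastMark (torusLetter (n := n + 1) (Sum.inr t)) (n + 1) = some n := by
    rw [lastMark, torusLetter_inr_last]
    rfl
  unfold TorusAgree
  simp only [hm]
  constructor
  · rintro ⟨h₁, h₂⟩
    refine ⟨?_, fun u => ?_⟩
    · rw [← arcLetter_last p, ← h₁, torusLetter_inr_last]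
      rfl
    · by_cases hi : u = n
      · rw [hi, arcLetter_of_le _ le_rfl, arcLetter_of_le _ le_rfl]
      · rw [← arcLetter_of_ne p hi, ← h₂ u fun h => hi (Option.some.inj h).symm,
          torusLetter_inr_of_ne _ hi]
  · rintro ⟨hp, h⟩
    refine ⟨fun u => ?_, fun u hu => ?_⟩
    · by_cases hi : u = n
      · rw [hi, torusLetter_inr_last, arcLetter_last, hp]
        rfl
      · rw [torusLetter_inr_of_ne _ hi, arcLetter_of_ne _ hi, h]
    · have hi : u ≠ n := fun h => hu (by rw [h])
      rw [torusLetter_inr_of_ne _ hi, arcLetter_of_ne _ hi, h]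

open Classical in
theorem closeUp_eq_ite : ∀ {n : ℕ} (c : TorusWord n) (t : ArcWord n),
    closeUp n c t = if TorusAgree c t ∧ arcTau t = torusTau c + 1 then 1 else 0
  | 0, c, t => by
    have : TorusAgree c t := ⟨fun _ => rfl, fun _ _ => rfl⟩
    simp only [this]
    rcases c with ⟨_ | _, _ | _⟩ <;> rcases t with _ | _ <;>
      simp [closeUp, arcTau, torusTau, signVal]
  | n + 1, Sum.inl c, p => by
    rw [torusAgree_inl, arcTau, torusTau]
    obtain ⟨t, l⟩ := p
    rcases l with _ | ε
    · refine (closeUp_eq_ite c t).trans ?_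
      simp [letterTau]
    · rw [if_neg fun h => by simp at h]
      rfl
  | n + 1, Sum.inr t, p => by
    rw [torusAgree_inr, arcTau, torusTau]
    obtain ⟨t', l⟩ := p
    rcases l with _ | _ | _
    · rw [if_neg fun h => by simp at h]
      rfl
    -- Equal letters leave only the base sign open, and τ fixes it.
    · have h : (∀ i, arcLetter t i = arcLetter t' i) ∧ arcTau t' = arcTau t ↔ t = t' := by
        refine ⟨fun ⟨h, h'⟩ => arcWord_ext h (signVal_injective ?_),
          fun h => h ▸ ⟨fun _ => rfl, rfl⟩⟩
        have := arcTau_sub_signVal h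
        linarith
      have : ∀ a b : ℤ, a + 1 = b + 1 ↔ a = b := fun a b => by omega
      simp [closeUp, letterTau, signVal, this, h]
    · have : ∀ a b : ℤ, a + -1 = b + 1 ↔ a = b + 2 := fun a b => by omega
      simp [closeUp, letterTau, signVal, this, baseX_eq_ite]

theorem cyclicMark_inl (c : TorusWord n) {v : ℕ} :
    cyclicMark (n + 1) (torusLetter (n := n + 1) (Sum.inl c)) v =
      cyclicMark n (torusLetter c) v := by
  unfold cyclicMark
  congr 1
  rw [lastMark, torusLetter_inl, torusLetter_of_le _ le_rfl]
  rfl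

theorem cyclicMark_inr (t : ArcWord n) {v : ℕ} (hv : v ≤ n) :
    cyclicMark (n + 1) (torusLetter (n := n + 1) (Sum.inr t)) v =
      (lastMark (arcLetter t) v).or (some n) := by
  unfold cyclicMark
  congr 1
  · exact lastMark_congr fun i hi => torusLetter_inr_of_ne t (hi.trans_le hv).ne
  · rw [lastMark, torusLetter_inr_last]
    rfl

theorem torusIncident_inl {c c' : TorusWord n} {v : ℕ} :
    TorusIncident (n := n + 1) v (Sum.inl c) (Sum.inl c') ↔ TorusIncident v c c' := by
  unfold TorusIncident
  rw [cyclicMark_inl]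
  rfl

/-- The base circle of the row starts at crossing `n` of the closed braid, where the cyclic search
ends if no earlier mark is found. The condition on base signs is thus the condition on letters at
`n`. -/
theorem torusIncident_inr {t t' : ArcWord n} {v : ℕ} (hv : v < n) :
    TorusIncident (n := n + 1) v (Sum.inr t) (Sum.inr t') ↔ ArcIncident v t t' := by
  unfold TorusIncident ArcIncident
  rw [cyclicMark_inr _ hv.le, torusLetter_inr_of_ne _ hv.ne, torusLetter_inr_of_ne _ hv.ne]
  refine and_congr_right fun _ => and_congr_right fun _ => and_congr ?_ (and_congr Iff.rfl ?_)
  · refine forall_congr' fun u => imp_congr_right fun hu => ?_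
    by_cases hi : u = n
    · rw [hi, torusLetter_inr_last, torusLetter_inr_last, arcLetter_of_le _ le_rfl,
        arcLetter_of_le _ le_rfl]
      simp
    · rw [torusLetter_inr_of_ne _ hi, torusLetter_inr_of_ne _ hi]
  · constructor
    · intro h
      refine ⟨fun u hu hu' => ?_, fun h' => ?_⟩
      · by_cases hi : u = n
        · rw [hi, arcLetter_of_le _ le_rfl, arcLetter_of_le _ le_rfl]
        · have := h u hu (by
            rcases hl : lastMark (arcLetter t) v with _ | j
            · simpa using Ne.symm hi
            · rw [hl] at hu'
              simpa using hu')
          rwa [torusLetter_inr_of_ne _ hi, torusLetter_inr_of_ne _ hi] at this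
      · have := h n hv.ne' (by
          rcases hl : lastMark (arcLetter t) v with _ | j
          · exact absurd hl h'
          · have := lastMark_lt hl
            simp only [Option.some_or, ne_eq, Option.some.injEq]
            omega)
        rw [torusLetter_inr_last, torusLetter_inr_last] at this
        exact Option.some.inj this
    · rintro ⟨h, h'⟩ u hu hu'
      by_cases hi : u = n
      · rw [hi, torusLetter_inr_last, torusLetter_inr_last, h' fun hl => hu' (by simp [hl, hi])]
      · rw [torusLetter_inr_of_ne _ hi, torusLetter_inr_of_ne _ hi]
        exact h u hu fun hl => hu' (by simp [hl])

theorem torusIncident_last {c : TorusWord n} {t : ArcWord n} :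
    TorusIncident (n := n + 1) n (Sum.inl c) (Sum.inr t) ↔
      TorusAgree c t ∧ arcTau t = torusTau c + 1 := by
  have hm : cyclicMark n (torusLetter c) n = lastMark (torusLetter c) n := Option.or_self
  unfold TorusIncident TorusAgree
  rw [cyclicMark_inl, hm, torusLetter_inl, torusLetter_inr_last]
  constructor
  · rintro ⟨-, -, h₁, h₂, h₃⟩
    refine ⟨⟨fun u => ?_, fun u hu => ?_⟩, h₂⟩
    · by_cases hi : u = n
      · rw [hi, arcLetter_of_le _ le_rfl, torusLetter_of_le _ le_rfl]
      · rw [← torusLetter_inr_of_ne t hi, ← h₁ u hi, torusLetter_inl]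
    · by_cases hi : u = n
      · rw [hi, arcLetter_of_le _ le_rfl, torusLetter_of_le _ le_rfl]
      · rw [← torusLetter_inr_of_ne t hi, ← h₃ u hi hu, torusLetter_inl]
  · rintro ⟨⟨h₁, h₃⟩, h₂⟩
    refine ⟨torusLetter_of_le _ le_rfl, rfl, fun u hi => ?_, h₂, fun u hi hu => ?_⟩
    · rw [torusLetter_inr_of_ne t hi, ← h₁, torusLetter_inl]
    · rw [torusLetter_inr_of_ne t hi, ← h₃ u hu, torusLetter_inl]

open Classical in
/-- The matrix entries of the differential are signed incidence numbers. -/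
theorem torusDiff_eq_sum : ∀ {n : ℕ} (c c' : TorusWord n), torusDiff n c c' =
    ∑ v ∈ Finset.range n,
      if TorusIncident v c c' then (-1) ^ marksAfter n (torusLetter c) v else 0
  | 0, _, _ => rfl
  | n + 1, Sum.inl c, Sum.inl c' => by
    have h₀ : ¬ TorusIncident (n := n + 1) n (Sum.inl c) (Sum.inl c') := fun h => by
      have := h.2.1
      rw [torusLetter_inl, torusLetter_of_le _ le_rfl] at this
      cases this
    rw [Finset.sum_range_succ, if_neg h₀, add_zero]
    refine (torusDiff_eq_sum c c').trans (Finset.sum_congr rfl fun v hv => ?_)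
    rw [torusIncident_inl, marksAfter_succ _ (Finset.mem_range.1 hv), torusLetter_inl,
      torusLetter_of_le _ le_rfl]
    rfl
  | n + 1, Sum.inl c, Sum.inr t => by
    rw [Finset.sum_range_succ, Finset.sum_eq_zero, zero_add, torusIncident_last, marksAfter_last,
      pow_zero]
    · exact (closeUp_eq_ite c t).trans (by congr)
    · intro v hv
      refine if_neg fun h => ?_
      have := h.2.2.1 n (Finset.mem_range.1 hv).ne'
      rw [torusLetter_inl, torusLetter_of_le _ le_rfl, torusLetter_inr_last] at this
      cases this
  | n + 1, Sum.inr t, Sum.inr t' => by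
    have h₀ : ¬ TorusIncident (n := n + 1) n (Sum.inr t) (Sum.inr t') := fun h => by
      have := h.1
      rw [torusLetter_inr_last] at this
      cases this
    rw [Finset.sum_range_succ, if_neg h₀, add_zero]
    refine (congrArg Neg.neg (arcDiff_eq_sum t t')).trans ?_
    rw [← Finset.sum_neg_distrib]
    refine Finset.sum_congr rfl fun v hv => ?_
    have hv := Finset.mem_range.1 hv
    rw [torusIncident_inr hv, marksAfter_succ _ hv, torusLetter_inr_last,
      marksAfter_congr fun i hi => torusLetter_inr_of_ne t hi.ne]
    split_ifs
    · rw [pow_succ, mul_neg_one]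
    · simp_all
    · rfl
  | n + 1, Sum.inr t, Sum.inl c => by
    rw [Finset.sum_eq_zero]
    · rfl
    · intro v hv
      refine if_neg fun h => ?_
      rcases eq_or_ne v n with rfl | hv
      · have := h.1
        rw [torusLetter_inr_last] at this
        cases this
      · have := h.2.2.1 n hv.symm
        rw [torusLetter_inl, torusLetter_of_le _ le_rfl, torusLetter_inr_last] at this
        cases this

end Letters

/-! ### Gradings of words, and words from their letters -/

variable {m n : ℕ}

theorem arcSigma_eq_sum : ∀ {m : ℕ} (t : ArcWord m),
    arcSigma t = ∑ i ∈ Finset.range m, letterSigma (arcLetter t i)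
  | 0, _ => rfl
  | m + 1, p => by
    rw [Finset.sum_range_succ, arcSigma, arcSigma_eq_sum, arcLetter_last]
    congr 1
    exact Finset.sum_congr rfl fun i hi => by rw [arcLetter_of_ne _ (Finset.mem_range.1 hi).ne]

theorem arcTau_eq_sum : ∀ {m : ℕ} (t : ArcWord m),
    arcTau t = signVal (arcBase t) + ∑ i ∈ Finset.range m, letterTau (arcLetter t i)
  | 0, _ => (add_zero _).symm
  | m + 1, p => by
    rw [Finset.sum_range_succ, arcTau, arcTau_eq_sum, arcLetter_last, arcBase, add_assoc]
    congr 2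
    exact Finset.sum_congr rfl fun i hi => by rw [arcLetter_of_ne _ (Finset.mem_range.1 hi).ne]

theorem torusSigma_eq_sum : ∀ {n : ℕ} (c : TorusWord n),
    torusSigma c = ∑ i ∈ Finset.range n, letterSigma (torusLetter c i)
  | 0, _ => rfl
  | n + 1, Sum.inl c => by
    rw [Finset.sum_range_succ, torusSigma, torusSigma_eq_sum, torusLetter_inl,
      torusLetter_of_le _ le_rfl]
    rfl
  | n + 1, Sum.inr t => by
    rw [Finset.sum_range_succ, torusSigma, arcSigma_eq_sum, torusLetter_inr_last]
    congr 1
    exact Finset.sum_congr rfl fun i hi => by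
      rw [torusLetter_inr_of_ne _ (Finset.mem_range.1 hi).ne]

theorem torusTau_of_pair : ∀ {n : ℕ} {c : TorusWord n} {p : CircleSign × CircleSign},
    torusPair c = some p → torusTau c = signVal p.1 + signVal p.2
  | 0, _, _, h => by cases h; rfl
  | _ + 1, Sum.inl c, _, h => torusTau_of_pair (c := c) h
  | _ + 1, Sum.inr _, _, h => by cases h

theorem torusTau_eq_sum : ∀ {n : ℕ} {c : TorusWord n}, torusPair c = none →
    torusTau c = ∑ i ∈ Finset.range n, letterTau (torusLetter c i)
  | 0, _, h => by cases h
  | n + 1, Sum.inl c, h => by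
    rw [Finset.sum_range_succ, torusTau, torusTau_eq_sum (c := c) h, torusLetter_inl,
      torusLetter_of_le _ le_rfl]
    exact (add_zero _).symm
  | n + 1, Sum.inr t, _ => by
    rw [Finset.sum_range_succ, torusTau, arcTau_eq_sum, torusLetter_inr_last, add_comm]
    congr 1
    exact Finset.sum_congr rfl fun i hi => by
      rw [torusLetter_inr_of_ne _ (Finset.mem_range.1 hi).ne]

theorem torusLetter_of_pair : ∀ {n : ℕ} {c : TorusWord n} {p : CircleSign × CircleSign},
    torusPair c = some p → ∀ i, torusLetter c i = none
  | 0, _, _, _, _ => rfl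
  | _ + 1, Sum.inl c, _, h, i => torusLetter_of_pair (c := c) h i
  | _ + 1, Sum.inr _, _, h, _ => by cases h

theorem exists_torusLetter : ∀ {n : ℕ} {c : TorusWord n}, torusPair c = none →
    ∃ i < n, (torusLetter c i).isSome
  | 0, _, h => by cases h
  | n + 1, Sum.inl c, h => by
    obtain ⟨i, hi, h'⟩ := exists_torusLetter (c := c) h
    exact ⟨i, by omega, h'⟩
  | n + 1, Sum.inr t, _ => ⟨n, n.lt_succ_self, by rw [torusLetter_inr_last]; rfl⟩

theorem torusWord_ext : ∀ {n : ℕ} {c c' : TorusWord n},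
    (∀ i < n, torusLetter c i = torusLetter c' i) → torusPair c = torusPair c' → c = c'
  | 0, _, _, _, h => Option.some.inj h
  | n + 1, Sum.inl c, Sum.inl c', h, h' =>
    congrArg Sum.inl (torusWord_ext (fun i hi => h i (by omega)) h')
  | n + 1, Sum.inl c, Sum.inr t, h, _ => by
    have := h n n.lt_succ_self
    rw [torusLetter_inl, torusLetter_of_le _ le_rfl, torusLetter_inr_last] at this
    cases this
  | n + 1, Sum.inr t, Sum.inl c, h, _ => by
    have := h n n.lt_succ_self
    rw [torusLetter_inl, torusLetter_of_le _ le_rfl, torusLetter_inr_last] at this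
    cases this
  | n + 1, Sum.inr t, Sum.inr t', h, _ => by
    refine congrArg Sum.inr (arcWord_ext (fun i => ?_) ?_)
    · rcases lt_or_ge i n with hi | hi
      · rw [← torusLetter_inr_of_ne t hi.ne, h i (by omega), torusLetter_inr_of_ne t' hi.ne]
      · rw [arcLetter_of_le _ hi, arcLetter_of_le _ hi]
    · have := h n n.lt_succ_self
      rw [torusLetter_inr_last, torusLetter_inr_last] at this
      exact Option.some.inj this

theorem exists_arcWord (w : ℕ → Option CircleSign) (ε : CircleSign) :
    ∀ m, ∃ t : ArcWord m, arcBase t = ε ∧ ∀ i < m, arcLetter t i = w i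
  | 0 => ⟨ε, rfl, fun i hi => absurd hi (by omega)⟩
  | m + 1 => by
    obtain ⟨t, h, h'⟩ := exists_arcWord w ε m
    refine ⟨(t, w m), h, fun i hi => ?_⟩
    rcases eq_or_ne i m with rfl | hi'
    · exact if_pos rfl
    · exact (if_neg hi').trans (h' i (by omega))

theorem exists_torusWord (w : ℕ → Option CircleSign) (p : CircleSign × CircleSign) :
    ∀ n, ∃ c : TorusWord n, (∀ i < n, torusLetter c i = w i) ∧
      ((∀ i < n, w i = none) → torusPair c = some p)
  | 0 => ⟨p, fun i hi => absurd hi (by omega), fun _ => rfl⟩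
  | n + 1 => by
    rcases hw : w n with _ | ε
    · obtain ⟨c, h, h'⟩ := exists_torusWord w p n
      refine ⟨Sum.inl c, fun i hi => ?_, fun h => h' fun i hi => h i (by omega)⟩
      rcases eq_or_ne i n with rfl | hi'
      · rw [torusLetter_inl, torusLetter_of_le _ le_rfl, hw]
      · exact h i (by omega)
    · obtain ⟨t, h, h'⟩ := exists_arcWord w ε n
      refine ⟨Sum.inr t, fun i hi => ?_, fun h => absurd (h n n.lt_succ_self) (by simp [hw])⟩
      rcases eq_or_ne i n with rfl | hi'
      · rw [torusLetter_inr_last, hw, h]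
      · rw [torusLetter_inr_of_ne _ hi', h' i (by omega)]

theorem letterSigma_congr {l l' : Option CircleSign} (h : l.isSome = l'.isSome) :
    letterSigma l = letterSigma l' := by
  rcases l with _ | _ <;> rcases l' with _ | _ <;> first | rfl | cases h

theorem TorusIncident.torusSigma_eq {v : ℕ} (hv : v < n) {c c' : TorusWord n}
    (h : TorusIncident v c c') : torusSigma c' = torusSigma c - 2 := by
  obtain ⟨h₁, h₂, h₃, -, -⟩ := h
  have hv := Finset.mem_range.2 hv
  rw [torusSigma_eq_sum, torusSigma_eq_sum, ← Finset.add_sum_erase _ _ hv,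
    ← Finset.add_sum_erase _ _ hv, Finset.sum_congr rfl fun u hu =>
      letterSigma_congr (h₃ u (Finset.ne_of_mem_erase hu)), h₁]
  obtain ⟨ε, hε⟩ := Option.isSome_iff_exists.1 h₂
  rw [hε, letterSigma, letterSigma]
  ring

theorem degree_of_torusDiff_ne_zero {c c' : TorusWord n} (h : torusDiff n c c' ≠ 0) :
    torusSigma c' = torusSigma c - 2 ∧ torusTau c' = torusTau c + 1 := by
  classical
  rw [torusDiff_eq_sum] at h
  obtain ⟨v, hv, h⟩ := Finset.exists_ne_zero_of_sum_ne_zero h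
  have hi : TorusIncident v c c' := by
    by_contra hi
    exact h (if_neg hi)
  exact ⟨hi.torusSigma_eq (Finset.mem_range.1 hv), hi.2.2.2.1⟩

/-- `σ` of a generator of the reduced complex. -/
def reducedSigma (n : ℕ) : Reduced → ℤ
  | Sum.inl _ => n
  | Sum.inr (k, _) => n - 2 * (k + 1)

/-- `τ` of a generator of the reduced complex. -/
def reducedTau : Reduced → ℤ
  | Sum.inl (ε, ε') => signVal ε + signVal ε'
  | Sum.inr (k, ε) => signVal ε - k

/-- Only all-B words survive. Removing a `minus` circle raises τ by one; removing a `plus` circle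
lowers it by one, but the accompanying X raises it by two. -/
theorem degree_of_arcAug_ne_zero : ∀ {m : ℕ} {t : ArcWord m} {ε : CircleSign},
    arcAug m t ε ≠ 0 → arcSigma t = -m ∧ arcTau t = signVal ε - m
  | 0, t, ε, h => by
    have : t = ε := by
      by_contra h'
      exact h (Matrix.one_apply_ne h')
    rw [this]
    exact ⟨by simp [arcSigma], by simp [arcTau]⟩
  | m + 1, (t, none), ε, h => absurd rfl h
  | m + 1, (t, some minus), ε, h => by
    obtain ⟨h₁, h₂⟩ := degree_of_arcAug_ne_zero (t := t) (ε := ε) h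
    change arcSigma t + _ = _ ∧ arcTau t + _ = _
    rw [h₁, h₂]
    simp only [letterSigma, letterTau, signVal]
    push_cast
    exact ⟨by ring, by ring⟩
  | m + 1, (t, some plus), minus, h => absurd rfl h
  | m + 1, (t, some plus), plus, h => by
    obtain ⟨h₁, h₂⟩ := degree_of_arcAug_ne_zero (t := t) (ε := minus) (right_ne_zero_of_mul h)
    change arcSigma t + _ = _ ∧ arcTau t + _ = _
    rw [h₁, h₂]
    simp only [letterSigma, letterTau, signVal]
    push_cast
    exact ⟨by ring, by ring⟩

theorem degree_of_torusAug_ne_zero : ∀ {n : ℕ} {c : TorusWord n} {i : Reduced},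
    torusAug n c i ≠ 0 → torusSigma c = reducedSigma n i ∧ torusTau c = reducedTau i
  | 0, c, Sum.inl q, h => by
    have : c = q := by
      by_contra h'
      exact h (Matrix.one_apply_ne (n := CircleSign × CircleSign) h')
    rw [this]
    exact ⟨rfl, rfl⟩
  | 0, c, Sum.inr _, h => absurd rfl h
  | n + 1, Sum.inl c, i, h => by
    obtain ⟨h₁, h₂⟩ := degree_of_torusAug_ne_zero (c := c) (i := i) h
    rw [torusSigma, torusTau, h₁, h₂]
    rcases i with _ | _ <;> simp only [reducedSigma] <;> push_cast <;> exact ⟨by ring, trivial⟩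
  | n + 1, Sum.inr _, Sum.inl _, h => absurd rfl h
  | n + 1, Sum.inr t, Sum.inr (k, ε), h => by
    by_cases hk : k = n
    · subst hk
      obtain ⟨h₁, h₂⟩ := degree_of_arcAug_ne_zero (t := t) (ε := ε) (by simpa [torusAug] using h)
      rw [torusSigma, torusTau, h₁, h₂]
      simp only [reducedSigma, reducedTau]
      push_cast
      exact ⟨by ring, trivial⟩
    · exact absurd (if_neg hk) h

end TorusModel

/-! ### Circles and enhanced states of a general diagram -/

namespace PDCode

variable {X E : Type}

/-- A function on edges that is constant along arcs is constant on circles. -/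
theorem eq_of_circleOf_eq (D : PDCode X E) (s : X → Marker) {α : Type*} (f : E → α)
    (hf : ∀ e e', D.Arc s e e' → f e = f e') {e e' : E} (h : D.circleOf s e = D.circleOf s e') :
    f e = f e' :=
  congrArg (Quot.lift f fun a b hab => by
    induction (hab : Relation.EqvGen (D.Arc s) a b) with
    | rel _ _ h => exact hf _ _ h
    | refl => rfl
    | symm _ _ _ ih => exact ih.symm
    | trans _ _ _ _ _ ih ih' => exact ih.trans ih') h

/-- The signs of circles given by signs of edges that are constant along arcs. -/
def circleLift (D : PDCode X E) (s : X → Marker) {α : Type*} (f : E → α)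
    (hf : ∀ e e', D.Arc s e e' → f e = f e') : D.Circle s → α :=
  Quotient.lift f fun _ _ h => D.eq_of_circleOf_eq s f hf (Quotient.sound h)

theorem circleOf_eq_of_arc (D : PDCode X E) {s : X → Marker} {e e' : E} (h : D.Arc s e e') :
    D.circleOf s e = D.circleOf s e' :=
  Quotient.sound (Relation.EqvGen.rel _ _ h)

theorem enhancedState_ext {D : PDCode X E} {S S' : D.EnhancedState} (h : S.1 = S'.1)
    (h' : ∀ e, S.2 (D.circleOf S.1 e) = S'.2 (D.circleOf S'.1 e)) : S = S' := by
  obtain ⟨s, f⟩ := S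
  obtain ⟨s', f'⟩ := S'
  obtain rfl : s = s' := h
  congr 1
  funext c
  induction c using Quotient.inductionOn with
  | h e => exact h' e

theorem signVal_sum {C : Type*} [Fintype C] (f : C → CircleSign) :
    (Nat.card {c // f c = CircleSign.plus} : ℤ) - Nat.card {c // f c = CircleSign.minus} =
      ∑ c, TorusModel.signVal (f c) := by
  have h : ∀ c, TorusModel.signVal (f c) =
      (if f c = CircleSign.plus then 1 else 0) - if f c = CircleSign.minus then 1 else 0 :=
    fun c => by rcases f c with _ | _ <;> rfl
  simp only [h, Finset.sum_sub_distrib, Finset.sum_boole, Nat.card_eq_fintype_card,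
    Fintype.card_subtype]

theorem sigma_eq_sum {D : PDCode X E} [Fintype X] (S : D.EnhancedState) :
    sigma S = ∑ v, if S.1 v = Marker.A then 1 else -1 := by
  have h : ∀ v, (if S.1 v = Marker.A then 1 else -1 : ℤ) =
      (if S.1 v = Marker.A then 1 else 0) - if S.1 v = Marker.B then 1 else 0 :=
    fun v => by rcases S.1 v with _ | _ <;> rfl
  simp only [h, sigma, Finset.sum_sub_distrib, Finset.sum_boole, Nat.card_eq_fintype_card,
    Fintype.card_subtype]

end PDCode

namespace TorusModel

open Matrix CircleSign PDCode

/-! ### Cyclic marks and the effect of a new mark -/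

section Marks

variable {n : ℕ} {w w' : ℕ → Option CircleSign}

theorem isSome_of_lastMark : ∀ {j u : ℕ}, lastMark w j = some u → (w u).isSome
  | j + 1, u, h => by
    rw [lastMark] at h
    split_ifs at h with h'
    · obtain rfl := Option.some.inj h
      exact h'
    · exact isSome_of_lastMark h

theorem cyclicMark_eq_some {j u : ℕ} (h : cyclicMark n w j = some u) :
    lastMark w j = some u ∨ lastMark w j = none ∧ lastMark w n = some u := by
  unfold cyclicMark at h
  rcases hl : lastMark w j with _ | u'
  · rw [hl] at h
    exact Or.inr ⟨rfl, h⟩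
  · rw [hl] at h
    exact Or.inl h

theorem isSome_of_cyclicMark {j u : ℕ} (h : cyclicMark n w j = some u) : (w u).isSome := by
  rcases cyclicMark_eq_some h with h | h
  · exact isSome_of_lastMark h
  · exact isSome_of_lastMark h.2

theorem lt_of_cyclicMark {j u : ℕ} (hj : j ≤ n) (h : cyclicMark n w j = some u) : u < n := by
  rcases cyclicMark_eq_some h with h | h
  · exact (lastMark_lt h).trans_le hj
  · exact lastMark_lt h.2

theorem cyclicMark_self : cyclicMark n w n = cyclicMark n w 0 := Option.or_self

theorem cyclicMark_succ_of_none {v : ℕ} (h : w v = none) :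
    cyclicMark n w (v + 1) = cyclicMark n w v := by
  rw [cyclicMark, lastMark, h]
  rfl

theorem cyclicMark_succ_of_isSome {v : ℕ} (h : (w v).isSome) :
    cyclicMark n w (v + 1) = some v := by
  rw [cyclicMark, lastMark, if_pos h]
  rfl

theorem lastMark_ne_none : ∀ {j i : ℕ}, i < j → (w i).isSome → lastMark w j ≠ none
  | j + 1, i, hi, h => by
    rw [lastMark]
    split_ifs with hj
    · exact Option.some_ne_none _
    · rcases eq_or_ne i j with rfl | hij
      · exact absurd h hj
      · exact lastMark_ne_none (by omega) h

theorem exists_cyclicMark {i : ℕ} (hi : i < n) (h : (w i).isSome) (j : ℕ) :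
    ∃ u, cyclicMark n w j = some u := by
  unfold cyclicMark
  rcases lastMark w j with _ | u
  · exact Option.ne_none_iff_exists'.1 (lastMark_ne_none hi h)
  · exact ⟨u, rfl⟩

theorem lastMark_of_isSome_eq : ∀ {j : ℕ}, (∀ i < j, (w i).isSome = (w' i).isSome) →
    lastMark w j = lastMark w' j
  | 0, _ => rfl
  | j + 1, h => by
    rw [lastMark, lastMark, h j j.lt_succ_self,
      lastMark_of_isSome_eq fun i hi => h i (hi.trans j.lt_succ_self)]

/-- Searching down from `j`, either a common mark above `v` is met first, or `w'` stops at `v` while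
`w` continues as from `v`. -/
theorem lastMark_of_insert {v : ℕ} (h₁ : w v = none) (h₂ : (w' v).isSome)
    (h : ∀ u, u ≠ v → (w u).isSome = (w' u).isSome) : ∀ {j : ℕ}, v < j →
      ∃ u, lastMark w' j = some u ∧
        (lastMark w j = some u ∨ u = v ∧ lastMark w j = lastMark w v)
  | j + 1, hj => by
    rw [lastMark, lastMark]
    rcases eq_or_ne j v with rfl | hj'
    · exact ⟨j, by rw [if_pos h₂], Or.inr ⟨rfl, by rw [h₁]; rfl⟩⟩
    · rw [← h j hj']
      split_ifs
      · exact ⟨j, rfl, Or.inl rfl⟩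
      · exact lastMark_of_insert h₁ h₂ h (by omega)

/-- Only the circle through `v` is cut by the new mark; every other circle keeps its start. -/
theorem cyclicMark_of_insert {v j : ℕ} (hv : v < n) (h₁ : w v = none) (h₂ : (w' v).isSome)
    (h : ∀ u, u ≠ v → (w u).isSome = (w' u).isSome) (hj : cyclicMark n w j ≠ cyclicMark n w v) :
    cyclicMark n w' j = cyclicMark n w j := by
  rcases lt_or_ge v j with hvj | hvj
  · obtain ⟨u, hu, hu' | ⟨rfl, hu'⟩⟩ := lastMark_of_insert h₁ h₂ h hvj
    · rw [cyclicMark, cyclicMark, hu, hu']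
      rfl
    · exact absurd (by rw [cyclicMark, cyclicMark, hu']) hj
  · have hl : lastMark w j = lastMark w' j := lastMark_of_isSome_eq fun i hi => h i (by omega)
    rcases hlj : lastMark w j with _ | u
    · obtain ⟨u, hu, hu' | ⟨rfl, hu'⟩⟩ := lastMark_of_insert h₁ h₂ h hv
      · rw [cyclicMark, cyclicMark, ← hl, hlj, hu, hu']
      · refine absurd ?_ hj
        rw [cyclicMark, cyclicMark, hlj, ← hu', Option.or_self]
        rfl
    · rw [cyclicMark, cyclicMark, ← hl, hlj]
      rfl

end Marks

/-! ### Words as enhanced states of the braid closure -/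

section Diagram

variable {n : ℕ}

/-- The edge at the side `b` that enters the crossing `j` of the closed braid from below, with `j`
taken modulo `n`. -/
def braidEdge (hn : 0 < n) (j : ℕ) (b : Bool) : Fin n × Bool := (⟨j % n, Nat.mod_lt _ hn⟩, b)

theorem braidEdge_coe (hn : 0 < n) (v : Fin n) (b : Bool) : braidEdge hn v b = (v, b) := by
  simp [braidEdge, Nat.mod_eq_of_lt v.2]

theorem braidEdge_self (hn : 0 < n) (b : Bool) : braidEdge hn n b = braidEdge hn 0 b := by
  simp [braidEdge]

theorem braidEdge_succ (hn : 0 < n) (v : Fin n) (b : Bool) :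
    braidEdge hn (v + 1) b = (finRotate n v, b) := by
  obtain ⟨k, rfl⟩ : ∃ k, n = k + 1 := ⟨n - 1, by omega⟩
  rw [finRotate_apply]
  refine Prod.ext (Fin.ext ?_) rfl
  simp [braidEdge, Fin.val_add]

theorem exists_braidEdge (hn : 0 < n) (e : Fin n × Bool) :
    ∃ j < n, ∃ b, e = braidEdge hn j b :=
  ⟨e.1, e.1.2, e.2, (braidEdge_coe hn e.1 e.2).symm⟩

theorem torusLinkDiagram_label (hn : 0 < n) (v : Fin n) : (torusLinkDiagram n).label v =
    ![braidEdge hn v true, braidEdge hn (v + 1) true, braidEdge hn (v + 1) false,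
      braidEdge hn v false] := by
  rw [braidEdge_coe, braidEdge_coe, braidEdge_succ, braidEdge_succ]
  rfl

/-- A function on edges is constant along arcs if it is so at every crossing. -/
theorem eq_of_arc (hn : 0 < n) {s : Fin n → Marker} {α : Type*} {f : Fin n × Bool → α}
    (hA : ∀ v : Fin n, s v = Marker.A → ∀ b, f (braidEdge hn v b) = f (braidEdge hn (v + 1) b))
    (hB : ∀ v : Fin n, s v = Marker.B → ∀ j, f (braidEdge hn j true) = f (braidEdge hn j false))
    (e e' : Fin n × Bool) (h : (torusLinkDiagram n).Arc s e e') : f e = f e' := by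
  obtain ⟨v, ⟨hs, ⟨rfl, rfl⟩ | ⟨rfl, rfl⟩⟩ | ⟨hs, ⟨rfl, rfl⟩ | ⟨rfl, rfl⟩⟩⟩ := h <;>
    rw [torusLinkDiagram_label hn]
  · exact hA v hs true
  · exact (hA v hs false).symm
  · exact hB v hs v
  · exact hB v hs (v + 1)

theorem circleOf_of_A (hn : 0 < n) {s : Fin n → Marker} {v : Fin n} (hs : s v = Marker.A)
    (b : Bool) :
    (torusLinkDiagram n).circleOf s (braidEdge hn (v + 1) b) =
      (torusLinkDiagram n).circleOf s (braidEdge hn v b) := by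
  cases b
  · refine circleOf_eq_of_arc _ ⟨v, Or.inl ⟨hs, Or.inr ⟨?_, ?_⟩⟩⟩ <;>
      rw [torusLinkDiagram_label hn] <;> rfl
  · refine (circleOf_eq_of_arc _ ⟨v, Or.inl ⟨hs, Or.inl ⟨?_, ?_⟩⟩⟩).symm <;>
      rw [torusLinkDiagram_label hn] <;> rfl

theorem circleOf_of_B (hn : 0 < n) {s : Fin n → Marker} {v : Fin n} (hs : s v = Marker.B)
    (b : Bool) :
    (torusLinkDiagram n).circleOf s (braidEdge hn (v + 1) b) =
      (torusLinkDiagram n).circleOf s (braidEdge hn (v + 1) true) := by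
  cases b
  · refine (circleOf_eq_of_arc _ ⟨v, Or.inr ⟨hs, Or.inr ⟨?_, ?_⟩⟩⟩).symm <;>
      rw [torusLinkDiagram_label hn] <;> rfl
  · rfl

/-- The state that puts the marker `B` on the crossings that carry a sign. -/
def markerOf (w : ℕ → Option CircleSign) (v : Fin n) : Marker :=
  if (w v).isSome then Marker.B else Marker.A

theorem markerOf_eq_A {w : ℕ → Option CircleSign} {v : Fin n} :
    markerOf w v = Marker.A ↔ w v = none := by
  unfold markerOf
  rcases w v with _ | _ <;> simp

theorem markerOf_eq_B {w : ℕ → Option CircleSign} {v : Fin n} :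
    markerOf w v = Marker.B ↔ (w v).isSome := by
  unfold markerOf
  rcases w v with _ | _ <;> simp

/-- Downwards from crossing `j`, A-markers continue an edge straight until the first B-marker is
met. -/
theorem circleOf_of_lastMark (hn : 0 < n) (w : ℕ → Option CircleSign) (b : Bool) :
    ∀ {j : ℕ}, j ≤ n →
      (∀ u, lastMark w j = some u → (torusLinkDiagram n).circleOf (markerOf w) (braidEdge hn j b) =
        (torusLinkDiagram n).circleOf (markerOf w) (braidEdge hn (u + 1) b)) ∧
      (lastMark w j = none → (torusLinkDiagram n).circleOf (markerOf w) (braidEdge hn j b) =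
        (torusLinkDiagram n).circleOf (markerOf w) (braidEdge hn 0 b))
  | 0, _ => ⟨fun _ h => (nomatch h), fun _ => rfl⟩
  | j + 1, hj => by
    rw [lastMark]
    by_cases hw : (w j).isSome
    · rw [if_pos hw]
      exact ⟨fun u hu => by rw [Option.some.inj hu], fun h => by cases h⟩
    · rw [if_neg hw, circleOf_of_A hn (v := ⟨j, hj⟩) (markerOf_eq_A.2 (by simpa using hw)) b]
      exact circleOf_of_lastMark hn w b (Nat.le_of_succ_le hj)

theorem circleOf_of_cyclicMark (hn : 0 < n) {w : ℕ → Option CircleSign} {j u : ℕ} (hj : j ≤ n)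
    (h : cyclicMark n w j = some u) (b : Bool) :
    (torusLinkDiagram n).circleOf (markerOf w) (braidEdge hn j b) =
      (torusLinkDiagram n).circleOf (markerOf w) (braidEdge hn (u + 1) true) := by
  have hB := circleOf_of_B hn (markerOf_eq_B (v := ⟨u, lt_of_cyclicMark hj h⟩).2
    (isSome_of_cyclicMark h)) b
  rw [← hB]
  rcases cyclicMark_eq_some h with h | ⟨h, h'⟩
  · exact (circleOf_of_lastMark hn w b hj).1 u h
  · rw [(circleOf_of_lastMark hn w b hj).2 h, ← braidEdge_self]
    exact (circleOf_of_lastMark hn w b le_rfl).1 u h'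

theorem cyclicMark_mod (hn : 0 < n) (w : ℕ → Option CircleSign) {v : ℕ} (hv : v ≤ n) :
    cyclicMark n w (v % n) = cyclicMark n w v := by
  rcases hv.lt_or_eq with hv | rfl
  · rw [Nat.mod_eq_of_lt hv]
  · rw [Nat.mod_self, cyclicMark_self]

/-- The cyclic mark is constant along arcs, so it separates circles; `circleOf_of_cyclicMark` is the
converse when there is a mark. -/
theorem cyclicMark_eq_of_circleOf_eq (hn : 0 < n) {w : ℕ → Option CircleSign} {e e' : Fin n × Bool}
    (h : (torusLinkDiagram n).circleOf (markerOf w) e =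
      (torusLinkDiagram n).circleOf (markerOf w) e') :
    cyclicMark n w e.1 = cyclicMark n w e'.1 := by
  refine PDCode.eq_of_circleOf_eq _ _ (fun e => cyclicMark n w e.1) (eq_of_arc hn ?_ ?_) h
  · intro v hs b
    simp only [braidEdge]
    rw [cyclicMark_mod hn w v.2.le, cyclicMark_mod hn w v.2,
      cyclicMark_succ_of_none (markerOf_eq_A.1 hs)]
  · intro v hs j
    rfl

theorem side_eq_of_circleOf_eq (hn : 0 < n) {w : ℕ → Option CircleSign} (hw : ∀ i, w i = none)
    {e e' : Fin n × Bool} (h : (torusLinkDiagram n).circleOf (markerOf w) e =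
      (torusLinkDiagram n).circleOf (markerOf w) e') : e.2 = e'.2 := by
  refine PDCode.eq_of_circleOf_eq (torusLinkDiagram n) (markerOf w) (fun e => e.2)
    (eq_of_arc hn (fun v _ b => rfl) fun v hs => ?_) h
  rw [markerOf_eq_B, hw] at hs
  cases hs

/-- The sign of the circle through an edge. -/
def edgeSign (c : TorusWord n) (e : Fin n × Bool) : CircleSign :=
  match torusPair c with
  | some p => bif e.2 then p.2 else p.1
  -- The default is never reached: if there is no pair, some crossing carries a sign and the cyclic
  -- search succeeds.
  | none => ((cyclicMark n (torusLetter c) e.1).bind (torusLetter c)).getD plus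

theorem edgeSign_of_pair {c : TorusWord n} {p : CircleSign × CircleSign} (h : torusPair c = some p)
    (e : Fin n × Bool) : edgeSign c e = bif e.2 then p.2 else p.1 := by
  rw [edgeSign, h]

theorem edgeSign_of_cyclicMark {c : TorusWord n} (h : torusPair c = none) {e : Fin n × Bool} {u : ℕ}
    (hu : cyclicMark n (torusLetter c) e.1 = some u) :
    torusLetter c u = some (edgeSign c e) := by
  rw [edgeSign, h]
  obtain ⟨ε, hε⟩ := Option.isSome_iff_exists.1 (isSome_of_cyclicMark hu)
  simp [hu, hε]

theorem torusPair_eq_none {c : TorusWord n} {i : ℕ} (h : (torusLetter c i).isSome) :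
    torusPair c = none := by
  rcases hp : torusPair c with _ | p
  · rfl
  · rw [torusLetter_of_pair hp] at h
    cases h

theorem edgeSign_succ (hn : 0 < n) {c : TorusWord n} {v : ℕ} (hv : v < n)
    (h : (torusLetter c v).isSome) (b : Bool) :
    torusLetter c v = some (edgeSign c (braidEdge hn (v + 1) b)) :=
  edgeSign_of_cyclicMark (torusPair_eq_none h) ((cyclicMark_mod hn _ hv).trans
    (cyclicMark_succ_of_isSome h))

theorem edgeSign_arc (hn : 0 < n) (c : TorusWord n) (e e' : Fin n × Bool)
    (h : (torusLinkDiagram n).Arc (markerOf (torusLetter c)) e e') :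
    edgeSign c e = edgeSign c e' := by
  refine eq_of_arc hn ?_ ?_ e e' h
  · intro v hs b
    unfold edgeSign
    simp only [braidEdge]
    rw [cyclicMark_mod hn _ v.2.le, cyclicMark_mod hn _ v.2,
      cyclicMark_succ_of_none (markerOf_eq_A.1 hs)]
  · intro v hs j
    unfold edgeSign
    rw [torusPair_eq_none (markerOf_eq_B.1 hs)]
    rfl

/-- The enhanced state encoded by a word. -/
def toState (hn : 0 < n) (c : TorusWord n) : (torusLinkDiagram n).EnhancedState :=
  ⟨markerOf (torusLetter c), PDCode.circleLift _ _ (edgeSign c) (edgeSign_arc hn c)⟩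

theorem toState_circleOf (hn : 0 < n) (c : TorusWord n) (e : Fin n × Bool) :
    (toState hn c).2 ((torusLinkDiagram n).circleOf (toState hn c).1 e) = edgeSign c e := rfl

theorem toState_injective (hn : 0 < n) : Function.Injective (toState hn) := by
  intro c c' h
  have h₁ : ∀ i < n, (torusLetter c i).isSome = (torusLetter c' i).isSome := fun i hi => by
    have := congrFun (congrArg Sigma.fst h) ⟨i, hi⟩
    rw [Bool.eq_iff_iff, ← markerOf_eq_B (v := ⟨i, hi⟩), ← markerOf_eq_B (v := ⟨i, hi⟩)]
    exact Eq.congr_left this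
  have h₂ : ∀ e, edgeSign c e = edgeSign c' e := fun e => by
    rw [← toState_circleOf hn, ← toState_circleOf hn, h]
  have h₃ : ∀ i < n, torusLetter c i = torusLetter c' i := fun i hi => by
    by_cases hs : (torusLetter c i).isSome
    · rw [edgeSign_succ hn hi hs true, edgeSign_succ hn hi (h₁ i hi ▸ hs) true, h₂]
    · have hs' := h₁ i hi ▸ hs
      rw [Option.not_isSome_iff_eq_none] at hs hs'
      rw [hs, hs']
  refine torusWord_ext h₃ ?_
  rcases hp : torusPair c with _ | p <;> rcases hp' : torusPair c' with _ | p'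
  · rfl
  · obtain ⟨i, hi, hs⟩ := exists_torusLetter hp
    rw [h₃ i hi, torusLetter_of_pair hp'] at hs
    cases hs
  · obtain ⟨i, hi, hs⟩ := exists_torusLetter hp'
    rw [← h₃ i hi, torusLetter_of_pair hp] at hs
    cases hs
  · have hf := h₂ (braidEdge hn 0 false)
    have ht := h₂ (braidEdge hn 0 true)
    rw [edgeSign_of_pair hp, edgeSign_of_pair hp'] at hf ht
    exact congrArg some (Prod.ext hf ht)

theorem toState_surjective (hn : 0 < n) : Function.Surjective (toState hn) := by
  intro S
  let D := torusLinkDiagram n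
  -- Letters are read off just above the B-crossings; the pair matters only if all markers are A.
  -- The remainder mod `n` merely turns `i` into an element of `Fin n`.
  obtain ⟨c, hc, hp⟩ := exists_torusWord
    (fun i => if S.1 ⟨i % n, Nat.mod_lt _ hn⟩ = Marker.B then
      some (S.2 (D.circleOf S.1 (braidEdge hn (i + 1) true))) else none)
    (S.2 (D.circleOf S.1 (braidEdge hn 0 false)), S.2 (D.circleOf S.1 (braidEdge hn 0 true))) n
  have hm : ∀ v : Fin n, (⟨v % n, Nat.mod_lt _ hn⟩ : Fin n) = v := fun v =>
    Fin.ext (Nat.mod_eq_of_lt v.2)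
  have hc' : ∀ v : Fin n, torusLetter c v = if S.1 v = Marker.B then
      some (S.2 (D.circleOf S.1 (braidEdge hn (v + 1) true))) else none := fun v => by
    rw [hc v v.2, hm]
  have hs : markerOf (torusLetter c) = S.1 := by
    funext v
    rcases hv : S.1 v with _ | _
    · rw [markerOf_eq_A, hc', hv]
      rfl
    · rw [markerOf_eq_B, hc', hv]
      rfl
  refine ⟨c, enhancedState_ext hs fun e => ?_⟩
  rw [toState_circleOf]
  obtain ⟨j, hj, b, rfl⟩ := exists_braidEdge hn e
  rcases hpc : torusPair c with _ | p
  · obtain ⟨i, hi, hs'⟩ := exists_torusLetter hpc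
    obtain ⟨u, hu⟩ := exists_cyclicMark hi hs' j
    have h₁ := circleOf_of_cyclicMark hn hj.le hu b
    rw [hs] at h₁
    have hun := lt_of_cyclicMark hj.le hu
    have h₂ := edgeSign_of_cyclicMark hpc (e := braidEdge hn j b)
      ((cyclicMark_mod hn _ hj.le).trans hu)
    rw [hc' ⟨u, hun⟩] at h₂
    split_ifs at h₂
    rw [h₁]
    exact (Option.some.inj h₂).symm
  · have hw := torusLetter_of_pair hpc
    have hl : lastMark (torusLetter c) j = none := by
      rcases hl : lastMark (torusLetter c) j with _ | u
      · rfl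
      · have := isSome_of_lastMark hl
        rw [hw] at this
        cases this
    have h₁ := (circleOf_of_lastMark hn (torusLetter c) b hj.le).2 hl
    rw [hs] at h₁
    rw [hp fun i hi => by rw [← hc i hi, hw]] at hpc
    rw [h₁, edgeSign_of_pair (hp fun i hi => by rw [← hc i hi, hw])]
    cases b <;> rfl

theorem sigma_toState (hn : 0 < n) (c : TorusWord n) : sigma (toState hn c) = torusSigma c := by
  rw [PDCode.sigma_eq_sum, torusSigma_eq_sum, Finset.sum_range]
  refine Finset.sum_congr rfl fun v _ => ?_
  change (if markerOf (torusLetter c) v = Marker.A then (1 : ℤ) else -1) = _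
  simp only [markerOf_eq_A]
  rcases torusLetter c v with _ | _ <;> rfl

/-- The circles correspond to the B-crossings at which they start or, if all markers are A, to the
two sides of the braid. -/
theorem tau_toState (hn : 0 < n) (c : TorusWord n) : tau (toState hn c) = torusTau c := by
  classical
  let D := torusLinkDiagram n
  let w := torusLetter c
  let _ : Fintype (D.Circle (markerOf w)) := Fintype.ofFinite _
  let f : D.Circle (markerOf w) → CircleSign := (toState hn c).2
  refine (signVal_sum f).trans ?_
  rcases hp : torusPair c with _ | p
  · have hu : ∀ v : {v : Fin n // (w v).isSome}, cyclicMark n w (braidEdge hn (v + 1) true).1 =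
        some v.1.1 := fun v => (cyclicMark_mod hn w v.1.2).trans (cyclicMark_succ_of_isSome v.2)
    have hb : Function.Bijective fun v : {v : Fin n // (w v).isSome} =>
        D.circleOf (markerOf w) (braidEdge hn (v + 1) true) := by
      constructor
      · intro v v' h
        have := cyclicMark_eq_of_circleOf_eq hn h
        rw [hu, hu] at this
        exact Subtype.ext (Fin.ext (Option.some.inj this))
      · intro x
        induction x using Quotient.inductionOn with
        | h e =>
          obtain ⟨j, hj, b, rfl⟩ := exists_braidEdge hn e
          obtain ⟨i, hi, hs⟩ := exists_torusLetter hp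
          obtain ⟨u, hu⟩ := exists_cyclicMark hi hs j
          exact ⟨⟨⟨u, lt_of_cyclicMark hj.le hu⟩, isSome_of_cyclicMark hu⟩,
            (circleOf_of_cyclicMark hn hj.le hu b).symm⟩
    rw [torusTau_eq_sum hp, Finset.sum_range, ← hb.sum_comp]
    have h₀ : ∀ v : Fin n, letterTau (w v) = if (w v).isSome then letterTau (w v) else 0 :=
      fun v => by rcases w v with _ | _ <;> rfl
    rw [Finset.sum_congr rfl fun v _ => h₀ v, ← Finset.sum_filter]
    rw [Finset.sum_subtype (F := inferInstance) _ (p := fun v : Fin n => (w v).isSome) (by simp)]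
    refine Finset.sum_congr rfl fun v _ => ?_
    have := edgeSign_succ hn v.1.2 v.2 true
    change signVal (edgeSign c _) = letterTau (torusLetter c v)
    rw [this]
    rfl
  · have hw := torusLetter_of_pair hp
    have hb : Function.Bijective fun b : Bool => D.circleOf (markerOf w) (braidEdge hn 0 b) := by
      constructor
      · intro b b' h
        exact side_eq_of_circleOf_eq hn hw h
      · intro x
        induction x using Quotient.inductionOn with
        | h e =>
          obtain ⟨j, hj, b, rfl⟩ := exists_braidEdge hn e
          refine ⟨b, ((circleOf_of_lastMark hn w b hj.le).2 ?_).symm⟩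
          rcases hl : lastMark w j with _ | u
          · rfl
          · have := isSome_of_lastMark hl
            rw [show w u = none from hw u] at this
            cases this
    rw [torusTau_of_pair hp, ← hb.sum_comp, Fintype.sum_bool]
    change signVal (edgeSign c _) + signVal (edgeSign c _) = _
    rw [edgeSign_of_pair hp, edgeSign_of_pair hp, add_comm]
    rfl

/-- Since `v` has marker A, a circle passes through `v` if and only if it contains one of the two
lower edges there. If some marker is B, this is the circle that starts at the cyclic mark of `v`. If
all markers are A, both circles pass through `v` and the condition on signs is empty. -/
theorem incidentAt_toState (hn : 0 < n) (v : Fin n) (c c' : TorusWord n) :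
    (torusLinkDiagram n).IncidentAt v (toState hn c) (toState hn c') ↔
      TorusIncident (v : ℕ) c c' := by
  unfold PDCode.IncidentAt TorusIncident
  rw [tau_toState, tau_toState]
  have hA : (toState hn c).1 v = Marker.A ↔ torusLetter c v = none := markerOf_eq_A
  have hB : (toState hn c').1 v = Marker.B ↔ (torusLetter c' v).isSome := markerOf_eq_B
  have hE : (∀ u : Fin n, u ≠ v → (toState hn c').1 u = (toState hn c).1 u) ↔
      ∀ u, u ≠ (v : ℕ) → (torusLetter c u).isSome = (torusLetter c' u).isSome := by
    constructor
    · intro h u hu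
      rcases lt_or_ge u n with hun | hun
      · have := h ⟨u, hun⟩ fun h' => hu (congrArg Fin.val h')
        rw [Bool.eq_iff_iff, ← markerOf_eq_B (v := ⟨u, hun⟩), ← markerOf_eq_B (v := ⟨u, hun⟩)]
        exact Eq.congr_left this.symm
      · rw [torusLetter_of_le _ hun, torusLetter_of_le _ hun]
    · intro h u hu
      have := h u fun h' => hu (Fin.ext h')
      change markerOf _ _ = markerOf _ _
      rw [markerOf, markerOf, this]
  rw [hA, hB, hE]
  refine and_congr_right fun h₁ => and_congr_right fun h₂ => and_congr_right fun h₃ =>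
    and_congr_right fun _ => ?_
  have hp' : torusPair c' = none := torusPair_eq_none h₂
  have hv : markerOf (torusLetter c) v = Marker.A := markerOf_eq_A.2 h₁
  have hlabel : ∀ e, (∀ i, (torusLinkDiagram n).circleOf (toState hn c).1
      ((torusLinkDiagram n).label v i) ≠ (torusLinkDiagram n).circleOf (toState hn c).1 e) ↔
      ∀ b, (torusLinkDiagram n).circleOf (markerOf (torusLetter c)) (braidEdge hn v b) ≠
        (torusLinkDiagram n).circleOf (markerOf (torusLetter c)) e := by
    intro e
    rw [torusLinkDiagram_label hn]
    constructor
    · rintro h (_ | _)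
      exacts [h 3, h 0]
    · intro h i
      fin_cases i
      · exact h true
      · exact fun h' => h true ((circleOf_of_A hn hv true).symm.trans h')
      · exact fun h' => h false ((circleOf_of_A hn hv false).symm.trans h')
      · exact h false
  simp only [hlabel, toState_circleOf]
  rcases hp : torusPair c with _ | p
  · constructor
    · intro h u hu hu'
      by_cases hs : (torusLetter c u).isSome
      · have hun : u < n := by
          by_contra hun
          rw [torusLetter_of_le _ (not_lt.1 hun)] at hs
          cases hs
        rw [edgeSign_succ hn hun hs true, edgeSign_succ hn hun (h₃ u hu ▸ hs) true, h]
        intro b hb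
        have := cyclicMark_eq_of_circleOf_eq hn hb
        simp only [braidEdge] at this
        rw [cyclicMark_mod hn _ v.2.le, cyclicMark_mod hn _ hun,
          cyclicMark_succ_of_isSome hs] at this
        exact hu' this
      · have hs' := h₃ u hu ▸ hs
        rw [Option.not_isSome_iff_eq_none] at hs hs'
        rw [hs, hs']
    · intro h e he
      obtain ⟨j, hj, b, rfl⟩ := exists_braidEdge hn e
      obtain ⟨i, hi, hs⟩ := exists_torusLetter hp
      obtain ⟨u, hu⟩ := exists_cyclicMark hi hs j
      have hne : cyclicMark n (torusLetter c) j ≠ cyclicMark n (torusLetter c) v := fun h' => by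
        refine he b ?_
        rw [circleOf_of_cyclicMark hn hj.le hu, circleOf_of_cyclicMark hn v.2.le (h' ▸ hu)]
      -- A circle that misses `v` has the same start in both states, so its sign is the same letter
      -- in both.
      have hu' := cyclicMark_of_insert v.2 h₁ h₂ h₃ hne
      rw [hu] at hu' hne
      have huv : u ≠ v := fun h' => by
        have := isSome_of_cyclicMark hu
        rw [h', h₁] at this
        cases this
      have := h u huv hne.symm
      rw [edgeSign_of_cyclicMark hp (e := braidEdge hn j b) ((cyclicMark_mod hn _ hj.le).trans hu),
        edgeSign_of_cyclicMark hp' (e := braidEdge hn j b)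
          ((cyclicMark_mod hn _ hj.le).trans hu')] at this
      exact (Option.some.inj this).symm
  · have hw := torusLetter_of_pair hp
    constructor
    · intro _ u hu _
      have := h₃ u hu
      rw [hw] at this
      rw [hw]
      exact (Option.not_isSome_iff_eq_none.1 (by rw [← this]; simp)).symm
    · intro _ e he
      obtain ⟨j, hj, b, rfl⟩ := exists_braidEdge hn e
      have hl : ∀ j, lastMark (torusLetter c) j = none := fun j => by
        rcases hl : lastMark (torusLetter c) j with _ | u
        · rfl
        · have := isSome_of_lastMark hl
          rw [hw] at this
          cases this
      refine absurd ?_ (he b)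
      rw [(circleOf_of_lastMark hn _ b hj.le).2 (hl j),
        (circleOf_of_lastMark hn _ b v.2.le).2 (hl v)]

/-- The coefficients of Khovanov's differential are the matrix entries of `torusDiff`. -/
theorem coefficient_toState (hn : 0 < n) (c c' : TorusWord n) :
    (torusLinkDiagram n).coefficient (toState hn c) (toState hn c') = torusDiff n c c' := by
  classical
  rw [torusDiff_eq_sum, Finset.sum_range]
  refine Finset.sum_congr rfl fun v _ => ?_
  rw [incidentAt_toState]
  have : Nat.card {u : Fin n // v < u ∧ (toState hn c).1 u = Marker.B} =
      marksAfter n (torusLetter c) v := by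
    rw [Nat.card_eq_fintype_card, Fintype.card_subtype, marksAfter, Finset.card_filter,
      Finset.card_filter, Finset.sum_range]
    refine Finset.sum_congr rfl fun u _ => ?_
    have : (toState hn c).1 u = Marker.B ↔ (torusLetter c u).isSome := markerOf_eq_B
    simp only [this, Fin.lt_def]
  rw [this]

end Diagram

/-! ### From diagram homology to reduced homology -/

section Transfer

variable {n : ℕ}

/-- The word `c` has bidegree `(a, b)`. -/
def WordDegree (a b : ℤ) (c : TorusWord n) : Prop :=
  a = torusSigma c ∧ b = torusSigma c + 2 * torusTau c

/-- The generator `i` of the reduced complex has bidegree `(a, b)`. -/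
def ReducedDegree (n : ℕ) (a b : ℤ) (i : Reduced) : Prop :=
  a = reducedSigma n i ∧ b = reducedSigma n i + 2 * reducedTau i

/-- Words of bidegree `(a, b)` encode the enhanced states of bidegree `(a, b)`. -/
noncomputable def bidegreeEquiv (hn : 0 < n) (a b : ℤ) :
    {c : TorusWord n // WordDegree a b c} ≃ (torusLinkDiagram n).BidegreeState a b :=
  (Equiv.ofBijective (toState hn) ⟨toState_injective hn, toState_surjective hn⟩).subtypeEquiv
    fun c => by
      change _ ↔ a = sigma (toState hn c) ∧ b = sigma (toState hn c) + 2 * tau (toState hn c)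
      rw [sigma_toState, tau_toState]
      rfl

theorem bidegreeEquiv_coe (hn : 0 < n) {a b : ℤ} (c : {c : TorusWord n // WordDegree a b c}) :
    (bidegreeEquiv hn a b c).1 = toState hn c.1 := rfl

open Classical in
/-- A chain of bidegree `(a, b)` as a function on all words. -/
noncomputable def chainToWords (hn : 0 < n) (a b : ℤ) :
    (torusLinkDiagram n).Chain a b →+ (TorusWord n → ℤ) where
  toFun x c := if h : WordDegree a b c then x (bidegreeEquiv hn a b ⟨c, h⟩) else 0
  map_zero' := by
    funext c
    split_ifs <;> rfl
  map_add' x y := by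
    funext c
    simp only [Pi.add_apply]
    split_ifs <;> simp

/-- The component of bidegree `(a, b)` of a function on words. -/
noncomputable def wordsToChain (hn : 0 < n) (a b : ℤ) (z : TorusWord n → ℤ) :
    (torusLinkDiagram n).Chain a b :=
  Finsupp.equivFunOnFinite.symm fun S => z ((bidegreeEquiv hn a b).symm S).1

theorem chainToWords_of_degree (hn : 0 < n) {a b : ℤ} (x : (torusLinkDiagram n).Chain a b)
    {c : TorusWord n} (h : WordDegree a b c) :
    chainToWords hn a b x c = x (bidegreeEquiv hn a b ⟨c, h⟩) := dif_pos h

theorem chainToWords_of_not_degree (hn : 0 < n) {a b : ℤ} (x : (torusLinkDiagram n).Chain a b)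
    {c : TorusWord n} (h : ¬ WordDegree a b c) : chainToWords hn a b x c = 0 := dif_neg h

theorem chainToWords_wordsToChain (hn : 0 < n) {a b : ℤ} (z : TorusWord n → ℤ) {c : TorusWord n}
    (h : WordDegree a b c) : chainToWords hn a b (wordsToChain hn a b z) c = z c := by
  rw [chainToWords_of_degree hn _ h, wordsToChain, Finsupp.equivFunOnFinite_symm_apply_apply,
    Equiv.symm_apply_apply]

theorem wordDegree_of_torusDiff_ne_zero {a b : ℤ} {c c' : TorusWord n} (h : torusDiff n c c' ≠ 0) :
    WordDegree (a + 2) b c ↔ WordDegree a b c' := by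
  obtain ⟨h₁, h₂⟩ := degree_of_torusDiff_ne_zero h
  unfold WordDegree
  rw [h₁, h₂]
  constructor <;> rintro ⟨h, h'⟩ <;> constructor <;> linarith

theorem reducedDegree_of_torusAug_ne_zero {a b : ℤ} {c : TorusWord n} {i : Reduced}
    (h : torusAug n c i ≠ 0) : WordDegree a b c ↔ ReducedDegree n a b i := by
  obtain ⟨h₁, h₂⟩ := degree_of_torusAug_ne_zero h
  unfold WordDegree ReducedDegree
  rw [h₁, h₂]

/-- The differential of a chain, as a matrix product. -/
theorem differential_apply (hn : 0 < n) {a a' b : ℤ} (x : (torusLinkDiagram n).Chain a b)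
    {c' : TorusWord n} (h' : WordDegree a' b c') :
    (torusLinkDiagram n).differential a a' b x (bidegreeEquiv hn a' b ⟨c', h'⟩) =
      (chainToWords hn a b x ᵥ* torusDiff n) c' := by
  classical
  have h₁ : ∀ S : (torusLinkDiagram n).BidegreeState a b,
      (∑ S' : (torusLinkDiagram n).BidegreeState a' b,
        (torusLinkDiagram n).coefficient S.1 S'.1 • Finsupp.single S' (1 : ℤ))
          (bidegreeEquiv hn a' b ⟨c', h'⟩) =
        (torusLinkDiagram n).coefficient S.1 (toState hn c') := fun S => by
    rw [Finsupp.finsetSum_apply, Finset.sum_eq_single (bidegreeEquiv hn a' b ⟨c', h'⟩)]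
    · rw [Finsupp.smul_apply, Finsupp.single_eq_same, smul_eq_mul, mul_one, bidegreeEquiv_coe]
    · intro S' _ hS'
      rw [Finsupp.smul_apply, Finsupp.single_eq_of_ne hS'.symm, smul_zero]
    · intro h
      exact absurd (Finset.mem_univ _) h
  rw [PDCode.differential, Finsupp.linearCombination_apply, Finsupp.sum_fintype _ _ (by simp),
    Finsupp.finsetSum_apply]
  simp only [Finsupp.smul_apply, h₁, smul_eq_mul]
  rw [← (bidegreeEquiv hn a b).sum_comp]
  simp only [bidegreeEquiv_coe, coefficient_toState]
  have h₂ : (chainToWords hn a b x ᵥ* torusDiff n) c' =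
      ∑ c with WordDegree a b c, chainToWords hn a b x c * torusDiff n c c' := by
    rw [Finset.sum_filter]
    refine Finset.sum_congr rfl fun c _ => ?_
    split_ifs with h
    · rfl
    · rw [chainToWords_of_not_degree hn x h, zero_mul]
  rw [h₂, Finset.sum_subtype (F := inferInstance) _ (p := WordDegree a b) (by simp)]
  refine Fintype.sum_congr _ _ fun c => ?_
  rw [chainToWords_of_degree hn x c.2]

/-- The differential is homogeneous, so the components discarded by `wordsToChain` do not reach this
bidegree. -/
theorem vecMul_torusDiff_wordsToChain (hn : 0 < n) {a b : ℤ} (z : TorusWord n → ℤ)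
    {c' : TorusWord n} (h : WordDegree a b c') :
    (chainToWords hn (a + 2) b (wordsToChain hn (a + 2) b z) ᵥ* torusDiff n) c' =
      (z ᵥ* torusDiff n) c' := by
  refine Finset.sum_congr rfl fun c _ => ?_
  by_cases h₀ : torusDiff n c c' = 0
  · exact (mul_eq_zero_of_right _ h₀).trans (mul_eq_zero_of_right _ h₀).symm
  · rw [chainToWords_wordsToChain hn z ((wordDegree_of_torusDiff_ne_zero h₀).2 h)]

theorem vecMul_torusDiff_of_not_degree (hn : 0 < n) {a b : ℤ}
    (x : (torusLinkDiagram n).Chain (a + 2) b) {c' : TorusWord n} (h : ¬ WordDegree a b c') :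
    (chainToWords hn (a + 2) b x ᵥ* torusDiff n) c' = 0 := by
  refine Finset.sum_eq_zero fun c _ => ?_
  by_cases h₀ : torusDiff n c c' = 0
  · exact mul_eq_zero_of_right _ h₀
  · rw [chainToWords_of_not_degree hn x fun h' => h ((wordDegree_of_torusDiff_ne_zero h₀).1 h'),
      zero_mul]

theorem chainToWords_differential (hn : 0 < n) {a b : ℤ}
    (x : (torusLinkDiagram n).Chain (a + 2) b) :
    chainToWords hn a b ((torusLinkDiagram n).differential (a + 2) a b x) =
      chainToWords hn (a + 2) b x ᵥ* torusDiff n := by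
  funext c
  by_cases h : WordDegree a b c
  · rw [chainToWords_of_degree hn _ h, differential_apply hn x h]
  · rw [chainToWords_of_not_degree hn _ h, vecMul_torusDiff_of_not_degree hn x h]

theorem chainToWords_injective (hn : 0 < n) (a b : ℤ) :
    Function.Injective (chainToWords hn a b) := by
  intro x y h
  refine Finsupp.ext fun S => ?_
  obtain ⟨⟨c, hc⟩, rfl⟩ := (bidegreeEquiv hn a b).surjective S
  rw [← chainToWords_of_degree hn x hc, h, chainToWords_of_degree hn y hc]

theorem differential_eq_zero_iff (hn : 0 < n) {a b : ℤ} (x : (torusLinkDiagram n).Chain a b) :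
    (torusLinkDiagram n).differential a (a - 2) b x = 0 ↔
      chainToWords hn a b x ᵥ* torusDiff n = 0 := by
  -- After this shift the target degree is a variable, as in `chainToWords_differential`.
  obtain ⟨a, rfl⟩ : ∃ a', a = a' + 2 := ⟨a - 2, by ring⟩
  rw [add_sub_cancel_right, ← chainToWords_differential,
    map_eq_zero_iff _ (chainToWords_injective hn a b)]

theorem differential_wordsToChain (hn : 0 < n) {a b : ℤ} (x : (torusLinkDiagram n).Chain a b)
    {z : TorusWord n → ℤ} (h : z ᵥ* torusDiff n = chainToWords hn a b x) :
    (torusLinkDiagram n).differential (a + 2) a b (wordsToChain hn (a + 2) b z) = x := by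
  refine chainToWords_injective hn a b ?_
  rw [chainToWords_differential]
  funext c
  by_cases hc : WordDegree a b c
  · rw [vecMul_torusDiff_wordsToChain hn z hc, h]
  · rw [vecMul_torusDiff_of_not_degree hn _ hc, chainToWords_of_not_degree hn x hc]

theorem torusAug_chainToWords_of_not_degree (hn : 0 < n) {a b : ℤ}
    (x : (torusLinkDiagram n).Chain a b) {i : Reduced} (h : ¬ ReducedDegree n a b i) :
    (chainToWords hn a b x ᵥ* torusAug n) i = 0 := by
  refine Finset.sum_eq_zero fun c _ => ?_
  by_cases h₀ : torusAug n c i = 0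
  · exact mul_eq_zero_of_right _ h₀
  · rw [chainToWords_of_not_degree hn x fun h' => h ((reducedDegree_of_torusAug_ne_zero h₀).1 h'),
      zero_mul]

theorem torusAug_wordsToChain (hn : 0 < n) {a b : ℤ} (z : TorusWord n → ℤ) {i : Reduced}
    (h : ReducedDegree n a b i) :
    (chainToWords hn a b (wordsToChain hn a b z) ᵥ* torusAug n) i = (z ᵥ* torusAug n) i := by
  refine Finset.sum_congr rfl fun c _ => ?_
  by_cases h₀ : torusAug n c i = 0
  · exact (mul_eq_zero_of_right _ h₀).trans (mul_eq_zero_of_right _ h₀).symm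
  · rw [chainToWords_wordsToChain hn z ((reducedDegree_of_torusAug_ne_zero h₀).2 h)]

/-- A function on the generators of the reduced complex lives on one circle in degrees at most
`n`. -/
def Bounded (n : ℕ) (x : Reduced → ℤ) : Prop := ∀ k, n ≤ k → ∀ ε, x (Sum.inr (k, ε)) = 0

theorem bounded_torusAug (z : TorusWord n → ℤ) : Bounded n (z ᵥ* torusAug n) :=
  fun _ hk ε => torusAug_inr_of_le z hk ε

/-- Lift `x` to any `z`. The retraction kills the boundary of `z`, which is therefore the boundary
of some `y` in the kernel. Then z - y is a cycle over `x`, and so is its component in the bidegree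
of `x`. -/
theorem exists_cycle (hn : 0 < n) {a b : ℤ} {x : Reduced → ℤ} (hx : Bounded n x)
    (hd : ∀ i, ¬ ReducedDegree n a b i → x i = 0) (hc : reducedDiff n x = 0) :
    ∃ y : (torusLinkDiagram n).Chain a b, (torusLinkDiagram n).differential a (a - 2) b y = 0 ∧
      chainToWords hn a b y ᵥ* torusAug n = x := by
  obtain ⟨z, rfl⟩ := exists_torusAug_eq x hx
  obtain ⟨y, hy, hy'⟩ := exists_torusDiff_eq (z ᵥ* torusDiff n) (torusDiff_torusDiff z)
    (by rw [torusAug_torusDiff, hc])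
  refine ⟨wordsToChain hn a b (z - y), ?_, ?_⟩
  · obtain ⟨a, rfl⟩ : ∃ a', a = a' + 2 := ⟨a - 2, by ring⟩
    rw [differential_eq_zero_iff hn]
    funext c
    by_cases h : WordDegree a b c
    · rw [vecMul_torusDiff_wordsToChain hn _ h, sub_vecMul, hy, sub_self]
    · rw [vecMul_torusDiff_of_not_degree hn _ h]
      rfl
  · funext i
    by_cases h : ReducedDegree n a b i
    · rw [torusAug_wordsToChain hn _ h, sub_vecMul, hy', sub_zero]
    · rw [torusAug_chainToWords_of_not_degree hn _ h, hd i h]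

/-- Lift `y` to `w`. Then x - d w is a cycle in the acyclic kernel of the retraction. -/
theorem exists_boundary (hn : 0 < n) {a b : ℤ} {x : (torusLinkDiagram n).Chain a b}
    (hx : (torusLinkDiagram n).differential a (a - 2) b x = 0) {y : Reduced → ℤ} (hy : Bounded n y)
    (h : reducedDiff n y = chainToWords hn a b x ᵥ* torusAug n) :
    ∃ z, (torusLinkDiagram n).differential (a + 2) a b z = x := by
  rw [differential_eq_zero_iff hn] at hx
  obtain ⟨w, rfl⟩ := exists_torusAug_eq y hy
  obtain ⟨v, hv, -⟩ := exists_torusDiff_eq (chainToWords hn a b x - w ᵥ* torusDiff n)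
    (by rw [sub_vecMul, hx, torusDiff_torusDiff, sub_zero])
    (by rw [sub_vecMul, torusAug_torusDiff, h, sub_self])
  exact ⟨_, differential_wordsToChain hn x (z := w + v)
    (by rw [add_vecMul, hv, add_sub_cancel])⟩

/-- The homology of the closed braid is that of the reduced complex. -/
theorem nonempty_homology_equiv (hn : 0 < n) {a b : ℤ} {G : Type} [AddCommGroup G]
    (ψ : (Reduced → ℤ) →+ G)
    (hsurj : ∀ g, ∃ x, Bounded n x ∧ (∀ i, ¬ ReducedDegree n a b i → x i = 0) ∧
      reducedDiff n x = 0 ∧ ψ x = g)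
    (hker : ∀ x, Bounded n x → (∀ i, ¬ ReducedDegree n a b i → x i = 0) → reducedDiff n x = 0 →
      ψ x = 0 → ∃ y, Bounded n y ∧ reducedDiff n y = x)
    (hzero : ∀ y, Bounded n y → ψ (reducedDiff n y) = 0) :
    Nonempty ((torusLinkDiagram n).KhovanovHomology a b ≃+ G) := by
  let K := LinearMap.ker ((torusLinkDiagram n).differential a (a - 2) b)
  let aug : (torusLinkDiagram n).Chain a b →+ (Reduced → ℤ) :=
    (Matrix.vecMulLinear (torusAug n)).toAddMonoidHom.comp (chainToWords hn a b)
  have haug : ∀ x, aug x = chainToWords hn a b x ᵥ* torusAug n := fun _ => rfl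
  -- The hypotheses on `ψ` identify the reduced homology in this bidegree with `G`; composed with
  -- the retraction, `ψ` is onto on cycles and has the boundaries as kernel.
  let Φ : K →ₗ[ℤ] G := ((ψ.comp aug).comp K.subtype.toAddMonoidHom).toIntLinearMap
  have hΦ : ∀ x : K, Φ x = ψ (aug x.1) := fun _ => rfl
  have hΦs : Function.Surjective Φ := fun g => by
    obtain ⟨x, h₁, h₂, h₃, h₄⟩ := hsurj g
    obtain ⟨y, hy, hy'⟩ := exists_cycle hn h₁ h₂ h₃
    exact ⟨⟨y, hy⟩, by rw [hΦ, haug, hy', h₄]⟩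
  have hΦk : (LinearMap.range ((torusLinkDiagram n).differential (a + 2) a b)).submoduleOf K =
      LinearMap.ker Φ := by
    ext x
    rw [Submodule.submoduleOf, Submodule.mem_comap, LinearMap.mem_ker, LinearMap.mem_range, hΦ,
      haug, Submodule.subtype_apply]
    constructor
    · rintro ⟨y, hy⟩
      rw [← hy, chainToWords_differential, torusAug_torusDiff]
      exact hzero _ (bounded_torusAug _)
    · intro h
      have hx : chainToWords hn a b x ᵥ* torusDiff n = 0 :=
        (differential_eq_zero_iff hn x.1).1 x.2
      obtain ⟨y, hy, hy'⟩ := hker _ (bounded_torusAug _)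
        (fun i hi => torusAug_chainToWords_of_not_degree hn _ hi)
        (by rw [← torusAug_torusDiff, hx, zero_vecMul]) h
      exact exists_boundary hn x.2 hy hy'
  exact ⟨((Submodule.quotEquivOfEq _ _ hΦk).trans
    (Φ.quotKerEquivOfSurjective hΦs)).toAddEquiv⟩

end Transfer

/-! ### Homology of the reduced complex -/

section Cases

variable {n : ℕ} {a b : ℤ}

theorem reducedDegree_inl {ε ε' : CircleSign} : ReducedDegree n a b (Sum.inl (ε, ε')) ↔
    a = n ∧ b = n + 2 * (signVal ε + signVal ε') := Iff.rfl

theorem reducedDegree_inr {k : ℕ} {ε : CircleSign} : ReducedDegree n a b (Sum.inr (k, ε)) ↔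
    a = n - 2 * (k + 1) ∧ b = n - 2 * (k + 1) + 2 * (signVal ε - k) := Iff.rfl

/-- The first grading determines `k`, the second then the sign. The only bidegree with two
generators is `(n, n)`, which contains 1⊗X and X⊗1. -/
theorem eq_of_reducedDegree_inr {k : ℕ} {ε : CircleSign} {i : Reduced}
    (h : ReducedDegree n a b (Sum.inr (k, ε))) (hi : ReducedDegree n a b i) :
    i = Sum.inr (k, ε) := by
  rw [reducedDegree_inr] at h
  rcases i with ⟨δ, δ'⟩ | ⟨j, δ⟩
  · rw [reducedDegree_inl] at hi
    omega
  · rw [reducedDegree_inr] at hi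
    obtain rfl : j = k := by omega
    have : signVal δ = signVal ε := by omega
    rw [signVal_injective this]

theorem eq_of_reducedDegree_inl {ε : CircleSign} {i : Reduced}
    (h : ReducedDegree n a b (Sum.inl (ε, ε))) (hi : ReducedDegree n a b i) :
    i = Sum.inl (ε, ε) := by
  rw [reducedDegree_inl] at h
  rcases i with ⟨δ, δ'⟩ | ⟨j, δ⟩
  · rw [reducedDegree_inl] at hi
    have : signVal δ + signVal δ' = signVal ε + signVal ε := by omega
    rcases ε with _ | _ <;> rcases δ with _ | _ <;> rcases δ' with _ | _ <;>
      simp [signVal] at this <;> rfl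
  · rw [reducedDegree_inr] at hi
    omega

theorem bounded_single {i : Reduced} (hi : ∀ k ε, i = Sum.inr (k, ε) → k < n) (g : ℤ) :
    Bounded n (Pi.single i g) := fun k hk ε =>
  Pi.single_eq_of_ne (M := fun _ => ℤ) (fun h => absurd (hi k ε h.symm) hk.not_gt) g

theorem bounded_zero : Bounded n 0 := fun _ _ _ => rfl

/-- A generator of the reduced complex that is alone in its bidegree, with no differential to or
from it, contributes an infinite cyclic group. -/
theorem homology_of_isolated (hn : 0 < n) {i : Reduced} (hv : ∀ k ε, i = Sum.inr (k, ε) → k < n)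
    (hi : ReducedDegree n a b i) (hu : ∀ j, ReducedDegree n a b j → j = i)
    (hout : ∀ g, reducedDiff n (Pi.single i g) = 0) (hin : ∀ y, reducedDiff n y i = 0) :
    Nonempty ((torusLinkDiagram n).KhovanovHomology a b ≃+ ℤ) := by
  refine nonempty_homology_equiv hn (Pi.evalAddMonoidHom (fun _ => ℤ) i)
    (fun g => ⟨Pi.single i g, bounded_single hv g,
      fun j hj => Pi.single_eq_of_ne (M := fun _ => ℤ) ?_ g, hout g,
      Pi.single_eq_same (M := fun _ => ℤ) i g⟩) (fun x _ hd _ h => ⟨0, bounded_zero, ?_⟩)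
    fun y _ => hin y
  · rintro rfl
    exact hj hi
  · rw [reducedDiff_zero]
    funext j
    by_cases hj : ReducedDegree n a b j
    · rw [hu j hj]
      exact h.symm
    · exact (hd j hj).symm

/-- The generators 1⊗X and X⊗1 have the same product, so the cycles are the multiples of their
difference, and one coordinate determines a cycle. No map arrives at 𝒜⊗𝒜. -/
theorem homology_inl_plus_minus (hn : 0 < n) (ha : a = n) (hb : b = n) :
    Nonempty ((torusLinkDiagram n).KhovanovHomology a b ≃+ ℤ) := by
  have hdeg : ∀ i, ReducedDegree n a b i →
      i = Sum.inl (plus, minus) ∨ i = Sum.inl (minus, plus) := by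
    rintro (⟨_ | _, _ | _⟩ | ⟨k, ε⟩) h
    · rw [reducedDegree_inl] at h
      simp only [signVal] at h
      omega
    · exact Or.inl rfl
    · exact Or.inr rfl
    · rw [reducedDegree_inl] at h
      simp only [signVal] at h
      omega
    · rw [reducedDegree_inr] at h
      omega
  have h₁ : ReducedDegree n a b (Sum.inl (plus, minus)) :=
    reducedDegree_inl.2 ⟨ha, by simp [signVal, hb]⟩
  have h₂ : ReducedDegree n a b (Sum.inl (minus, plus)) :=
    reducedDegree_inl.2 ⟨ha, by simp [signVal, hb]⟩
  refine nonempty_homology_equiv hn (Pi.evalAddMonoidHom (fun _ => ℤ) (Sum.inl (plus, minus)))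
    (fun g => ⟨fun i => match i with
      | Sum.inl (plus, minus) => g
      | Sum.inl (minus, plus) => -g
      | _ => 0, fun k _ ε => rfl, fun i hi => ?_, ?_, rfl⟩)
    (fun x _ hd hc h => ⟨0, bounded_zero, ?_⟩) fun y _ => rfl
  · rcases i with ⟨_ | _, _ | _⟩ | ⟨k, ε⟩
    · rfl
    · exact absurd h₁ hi
    · exact absurd h₂ hi
    · rfl
    · rfl
  · funext i
    rcases i with ⟨ε, ε'⟩ | ⟨_ | k, _ | _⟩ <;> simp [reducedDiff]
  · rw [reducedDiff_zero]
    have h' : x (Sum.inl (plus, minus)) = 0 := h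
    funext i
    by_cases hi : ReducedDegree n a b i
    · rcases hdeg i hi with rfl | rfl
      · exact h'.symm
      · have := congrFun hc (Sum.inr (0, plus))
        simp only [reducedDiff, if_pos hn, h', zero_add] at this
        exact this.symm
    · exact (hd i hi).symm

/-- This is the generator X in the target of 2X: every multiple is a cycle, and the even ones are
the boundaries. -/
theorem homology_torsion {k : ℕ} (hk : k + 1 < n) (ho : Odd k)
    (hi : ReducedDegree n a b (Sum.inr (k + 1, plus))) :
    Nonempty ((torusLinkDiagram n).KhovanovHomology a b ≃+ ZMod 2) := by
  refine nonempty_homology_equiv (by omega) ((Int.castAddHom (ZMod 2)).comp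
    (Pi.evalAddMonoidHom (fun _ => ℤ) (Sum.inr (k + 1, plus))))
    (fun g => ⟨Pi.single (Sum.inr (k + 1, plus)) (g.val : ℤ), bounded_single ?_ _,
      fun j hj => Pi.single_eq_of_ne ?_ _, ?_, ?_⟩)
    (fun x _ hd _ h => ?_) fun y _ => ?_
  · intro j ε h
    cases h
    exact hk
  · rintro rfl
    exact hj hi
  · funext i
    rcases i with ⟨ε, ε'⟩ | ⟨_ | j, _ | _⟩ <;> simp [reducedDiff]
  · simp
  · obtain ⟨m, hm⟩ := (ZMod.intCast_zmod_eq_zero_iff_dvd _ 2).1 h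
    refine ⟨Pi.single (Sum.inr (k, minus)) m, bounded_single ?_ _, ?_⟩
    · intro j ε h
      cases h
      omega
    · funext i
      by_cases h' : ReducedDegree n a b i
      · rw [eq_of_reducedDegree_inr hi h', reducedDiff, if_pos ⟨hk, ho⟩, Pi.single_eq_same]
        exact hm.symm
      · rw [hd i h']
        rcases i with ⟨ε, ε'⟩ | ⟨_ | j, _ | _⟩
        · rfl
        · simp [reducedDiff]
        · simp [reducedDiff]
        · have : j ≠ k := by
            rintro rfl
            exact h' hi
          simp [reducedDiff, this]
        · rfl
  · change ((reducedDiff n y (Sum.inr (k + 1, plus)) : ℤ) : ZMod 2) = 0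
    rw [reducedDiff, if_pos ⟨hk, ho⟩]
    push_cast
    rw [show (2 : ZMod 2) = 0 from rfl, zero_mul]

theorem homology_subsingleton (hn : 0 < n)
    (h : ∀ x, Bounded n x → (∀ i, ¬ ReducedDegree n a b i → x i = 0) → reducedDiff n x = 0 →
      ∃ y, Bounded n y ∧ reducedDiff n y = x) :
    Subsingleton ((torusLinkDiagram n).KhovanovHomology a b) := by
  obtain ⟨e⟩ := nonempty_homology_equiv (a := a) (b := b) (G := PUnit) hn 0
    (fun _ => ⟨0, bounded_zero, fun _ _ => rfl, reducedDiff_zero, rfl⟩)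
    (fun x h₁ h₂ h₃ _ => h x h₁ h₂ h₃) fun _ _ => rfl
  exact e.toEquiv.subsingleton

theorem homology_inl_plus_plus (hn : 0 < n) (h : ReducedDegree n a b (Sum.inl (plus, plus))) :
    Nonempty ((torusLinkDiagram n).KhovanovHomology a b ≃+ ℤ) := by
  refine homology_of_isolated hn (fun k ε h => by cases h) h (fun j => eq_of_reducedDegree_inl h)
    (fun g => ?_) fun y => rfl
  funext i
  rcases i with ⟨ε, ε'⟩ | ⟨_ | j, _ | _⟩ <;> simp [reducedDiff]

/-- `hin` rules out an incoming 2X. `hout` makes the outgoing differential vanish: X is killed by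
2X, for odd `k` the next map is zero, and for `k + 2 = n` there is none. -/
theorem homology_inr {k : ℕ} (hk : k + 1 < n) {ε : CircleSign}
    (h : ReducedDegree n a b (Sum.inr (k + 1, ε))) (hin : ε = minus ∨ Even k)
    (hout : ε = plus ∨ Odd k ∨ k + 2 = n) :
    Nonempty ((torusLinkDiagram n).KhovanovHomology a b ≃+ ℤ) := by
  refine homology_of_isolated (by omega) (fun j δ h => ?_) h
    (fun j => eq_of_reducedDegree_inr h) (fun g => ?_) fun y => ?_
  · cases h
    exact hk
  · funext i
    rcases i with ⟨δ, δ'⟩ | ⟨_ | j, _ | _⟩ <;> simp [reducedDiff]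
    intro hj ho
    rw [Pi.single_eq_of_ne]
    rintro ⟨⟩
    rcases hout with h | h | h
    · cases h
    · exact Nat.not_odd_iff_even.2 h.add_one ho
    · omega
  · cases ε
    · rcases hin with h | h
      · cases h
      · rw [reducedDiff, if_neg fun h' => Nat.not_odd_iff_even.2 h h'.2]
    · rfl

end Cases

end TorusModel

/-! ### Assembly of the cases -/

open TorusModel CircleSign in
theorem mainTheorem1 (n : ℕ) (hn : 0 < n) (a b : ℤ) :
    (((a = n ∧ b = n) ∨
        (2 ≤ n ∧ a = -n ∧ b = -3 * n) ∨
        (∃ s : ℕ, Even s ∧ s ≤ n ∧ a = n - 2 * s ∧ b = n - 4 * s + 4) ∨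
        (∃ s : ℕ, Odd s ∧ 3 ≤ s ∧ s ≤ n ∧ a = n - 2 * s ∧ b = n - 4 * s)) →
      Nonempty ((torusLinkDiagram n).KhovanovHomology a b ≃+ ℤ)) ∧
    ((∃ s : ℕ, Odd s ∧ 3 ≤ s ∧ s ≤ n ∧ a = n - 2 * s ∧ b = n - 4 * s + 4) →
      Nonempty ((torusLinkDiagram n).KhovanovHomology a b ≃+ ZMod 2)) ∧
    ((¬ ((a = n ∧ b = n) ∨
          (2 ≤ n ∧ a = -n ∧ b = -3 * n) ∨
          (∃ s : ℕ, Even s ∧ s ≤ n ∧ a = n - 2 * s ∧ b = n - 4 * s + 4) ∨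
          (∃ s : ℕ, Odd s ∧ 3 ≤ s ∧ s ≤ n ∧ a = n - 2 * s ∧ b = n - 4 * s)) ∧
        ¬ ∃ s : ℕ, Odd s ∧ 3 ≤ s ∧ s ≤ n ∧ a = n - 2 * s ∧ b = n - 4 * s + 4) →
      Subsingleton ((torusLinkDiagram n).KhovanovHomology a b)) := by
  refine ⟨?_, ?_, ?_⟩
  · rintro (⟨ha, hb⟩ | ⟨h, ha, hb⟩ | ⟨s, hs, hsn, ha, hb⟩ | ⟨s, hs, hs3, hsn, ha, hb⟩)
    · exact homology_inl_plus_minus hn ha hb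
    · obtain ⟨k, rfl⟩ : ∃ k, n = k + 2 := ⟨n - 2, by omega⟩
      refine homology_inr (k := k) (ε := minus) (by omega)
        (reducedDegree_inr.2 ?_) (Or.inl rfl) (Or.inr (Or.inr rfl))
      simp only [signVal]
      push_cast at *
      omega
    -- Homological step `s` is 𝒜⊗𝒜 for `s = 0`, and the copy of 𝒜 with index `s - 1` otherwise.
    · rcases s with _ | _ | k
      · refine homology_inl_plus_plus hn (reducedDegree_inl.2 ?_)
        simp only [signVal]
        push_cast at *
        omega
      · exact absurd hs (by decide)
      · refine homology_inr (k := k) (ε := plus) (by omega)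
          (reducedDegree_inr.2 ?_) (Or.inr ?_) (Or.inl rfl)
        · simp only [signVal]
          push_cast at *
          omega
        · simpa [Nat.even_add] using hs
    · obtain ⟨k, rfl⟩ : ∃ k, s = k + 2 := ⟨s - 2, by omega⟩
      refine homology_inr (k := k) (ε := minus) (by omega)
        (reducedDegree_inr.2 ?_) (Or.inl rfl) (Or.inr (Or.inl ?_))
      · simp only [signVal]
        push_cast at *
        omega
      · simpa [Nat.odd_add] using hs
  · rintro ⟨s, hs, hs3, hsn, ha, hb⟩
    obtain ⟨k, rfl⟩ : ∃ k, s = k + 2 := ⟨s - 2, by omega⟩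
    refine homology_torsion (k := k) (by omega) (by simpa [Nat.odd_add] using hs)
      (reducedDegree_inr.2 ?_)
    simp only [signVal]
    push_cast at *
    omega
  · rintro ⟨h, h'⟩
    simp only [not_or] at h
    obtain ⟨h₁, h₂, h₃, h₄⟩ := h
    refine homology_subsingleton hn fun x hx hd hc => ?_
    by_cases hx₀ : x = 0
    · exact ⟨0, bounded_zero, by rw [hx₀, reducedDiff_zero]⟩
    -- A generator `i` in the support of a nonzero cycle settles the matter: its bidegree is listed,
    -- or its coefficient contradicts the cycle condition, or `x` is a product in 𝒜 and hence a
    -- boundary.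
    obtain ⟨i, hi⟩ := Function.ne_iff.1 hx₀
    have hdi : ReducedDegree n a b i := by
      by_contra hdi
      exact hi (hd i hdi)
    have hk : ∀ k ε, i = Sum.inr (k, ε) → k < n := by
      rintro k ε rfl
      by_contra hk
      exact hi (hx k (not_lt.1 hk) ε)
    have hsingle : ∀ {k ε}, i = Sum.inr (k, ε) → ∀ j, j ≠ Sum.inr (k, ε) → x j = 0 := by
      rintro k ε rfl j hj
      exact hd j fun h => hj (eq_of_reducedDegree_inr hdi h)
    rcases i with ⟨_ | _, _ | _⟩ | ⟨_ | k, _ | _⟩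
    · rw [reducedDegree_inl] at hdi
      simp only [signVal] at hdi
      exact absurd ⟨0, by simp, by omega, by push_cast; omega, by push_cast; omega⟩ h₃
    · rw [reducedDegree_inl] at hdi
      simp only [signVal] at hdi
      omega
    · rw [reducedDegree_inl] at hdi
      simp only [signVal] at hdi
      omega
    -- The product of 1⊗1 is 1, so no nonzero multiple of it is a cycle.
    · have := congrFun hc (Sum.inr (0, minus))
      simp only [reducedDiff, if_pos hn] at this
      exact absurd this hi
    -- X is the product of X⊗1; in the next case 1 is the product of 1⊗1.
    · refine ⟨Pi.single (Sum.inl (plus, minus)) (x (Sum.inr (0, plus))),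
        bounded_single (fun k ε h => by cases h) _, funext fun j => ?_⟩
      by_cases hj : j = Sum.inr (0, plus)
      · rw [hj]
        simp [reducedDiff, hn]
      · rw [hsingle rfl j hj]
        rcases j with ⟨ε, ε'⟩ | ⟨_ | j, _ | _⟩ <;> simp_all [reducedDiff]
    · refine ⟨Pi.single (Sum.inl (minus, minus)) (x (Sum.inr (0, minus))),
        bounded_single (fun k ε h => by cases h) _, funext fun j => ?_⟩
      by_cases hj : j = Sum.inr (0, minus)
      · rw [hj]
        simp [reducedDiff, hn]
      · rw [hsingle rfl j hj]
        rcases j with ⟨ε, ε'⟩ | ⟨_ | j, _ | _⟩ <;> simp_all [reducedDiff]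
    · have hkn := hk _ _ rfl
      rw [reducedDegree_inr] at hdi
      simp only [signVal] at hdi
      rcases Nat.even_or_odd k with hk' | hk'
      · exact absurd ⟨k + 2, by simpa [Nat.even_add] using hk', by omega, by push_cast at *; omega,
          by push_cast at *; omega⟩ h₃
      · have := hk'.pos
        exact absurd ⟨k + 2, by simpa [Nat.odd_add] using hk', by omega, by omega,
          by push_cast at *; omega, by push_cast at *; omega⟩ h'
    · have hkn := hk _ _ rfl
      rw [reducedDegree_inr] at hdi
      simp only [signVal] at hdi
      rcases Nat.even_or_odd k with hk' | hk'
      -- The generator 1 is sent to twice X, so it supports no cycle, unless this is the last copy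
      -- of 𝒜, in bidegree (-n, -3n).
      · rcases Nat.lt_or_ge (k + 2) n with hlt | hge
        · have := congrFun hc (Sum.inr (k + 2, plus))
          rw [reducedDiff, if_pos ⟨hlt, hk'.add_one⟩] at this
          exact absurd (by simpa using this) hi
        · exact absurd ⟨by omega, by push_cast at *; omega, by push_cast at *; omega⟩ h₂
      · have := hk'.pos
        exact absurd ⟨k + 2, by simpa [Nat.odd_add] using hk', by omega, by omega,
          by push_cast at *; omega, by push_cast at *; omega⟩ h₄
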